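/- Setting. Let $\Sigma, M, \mathcal H$ be real Hilbert spaces with $M\subseteq\mathcal H\subseteq M^\star$ (continuous dense embedding), and let $a:\Sigma\times\Sigma\to\mathbb R$ and $b:\Sigma\times M\to\mathbb R$ be continuous bilinear forms such that $a$ is symmetric, positive definite and elliptic on the kernel of $b$, and $b$ satisfies the inf-sup condition. Write $|\tau|_a=a(\tau,\tau)^{1/2}$. For $g\in\mathcal H$ let $(Ag,Tg)\in\Sigma\times M$ be the solution of $$a(Ag,\tau)+b(\tau,Tg)=0\ \ \forall\tau\in\Sigma,\qquad b(Ag,v)=-(g,v)_{\mathcal H}\ \ \forall v\in M,$$ and assume that $T:\mathcal H\to\mathcal H$ is compact. Let $0<\lambda_1\le\lambda_2\le\cdots$ be all eigenvalues of the problem $a(\sigma,\tau)+b(\tau,u)=0$ $\forall\tau\in\Sigma$, $b(\sigma,v)=-\lambda(u,v)_{\mathcal H}$ $\forall v\in M$, repeated according to multiplicity, with $\mathcal H$-orthonormal eigenfunctions $u_1,u_2,\dots$. Fix $J=\{n+1,\dots,n+N\}$ and let $W=\operatorname{span}\{u_j: j\in J\}$. A discretization with constant $\rho$ is a pair of finite-dimensional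 subspaces $\Sigma_\ell\subset\Sigma$, $M_\ell\subset M$ such that (a) the functionals $b(\tau,\cdot)$, $\tau\in\Sigma_\ell$, are exactly the functionals $(w,\cdot)_{\mathcal H}$, $w\in M_\ell$, on $M$ (for the mixed Laplacian: $\operatorname{div}\Sigma_\ell=M_\ell$); (b) for every $g\in\mathcal H$ there is $\sigma_\ell\in\Sigma_\ell$ with $b(Ag-\sigma_\ell,v)=0$ for all $v\in M_\ell$ and $|Ag-\sigma_\ell|_a\le\rho\|g\|_{\mathcal H}$; (c) $\inf_{v\in M_\ell}\|Tg-v\|_{\mathcal H}\le\rho\|g\|_{\mathcal H}$ for every $g\in\mathcal H$. Let $A_\ell,T_\ell$ be the solution operators of the discrete source problem on $\Sigma_\ell\times M_\ell$, let $0<\lambda_{\ell,1}\le\dots\le\lambda_{\ell,\dim M_\ell}$ be the discrete eigenvalues with $\mathcal H$-orthonormal eigenfunctions $u_{\ell,k}$, and let $W_\ell=\operatorname{span}\{u_{\ell,k}: k\in J,\ k\le\dim M_\ell\}$. Put $$\delta(W,W_\ell)=\sup_{u\in W,\ \|u\|_{\mathcal H}=1}\ \inf_{v\in W_\ell}\Big(\|u-v\|_{\mathcal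 H}^2+|\mathsf G(u)-\mathsf G_\ell(v)|_a^2\Big)^{1/2},$$ where $\mathsf G(u)\in\Sigma$ solves $a(\mathsf G(u),\tau)+b(\tau,u)=0$ for all $\tau\in\Sigma$ and $\mathsf G_\ell(v)\in\Sigma_\ell$ solves $a(\mathsf G_\ell(v),\tau)+b(\tau,v)=0$ for all $\tau\in\Sigma_\ell$. Let $F_\ell:W\to W_\ell$ be the restriction to $W$ of the $\mathcal H$-orthogonal projection onto $W_\ell$. Proposition. The continuous source problem has a unique solution for each $g\in\mathcal H$. Moreover: (i) For all $R\in\mathbb R$ and $\theta<1$ there is a constant $C$ such that for every discretization with constant $R$ and every choice of discrete eigenfunctions for which $\delta(W,W_\ell)\le\theta$, the discrete source problem is uniquely solvable, $T(W)\subseteq W$, $T_\ell(W_\ell)\subseteq W_\ell$, $F_\ell$ is bijective, and the operators $\hat T=T|_W$ and $\hat T_\ell=F_\ell^{-1}T_\ell F_\ell$ from $W$ into itself satisfy $$\|\hat T-\hat T_\ell\|_{\mathcal L(W)}\le C\,\delta(W,W_\ell)^2,$$ with $W$ normed by $\|\cdot\|_{\mathcal H}$. (ii) If $\lambda_i\ne\lambda_k$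 for all $i\in J$ and $k\notin J$, then there are $\rho_0>0$ and $C$ such that the whole conclusion of (i) holds, without any condition on $\delta(W,W_\ell)$, for every discretization with constant $\rho_0$ and every choice of discrete eigenfunctions. -/

import Mathlib

open scoped RealInnerProductSpace

noncomputable section

namespace MixedEVP

variable {S M H : Type*}
  [NormedAddCommGroup S] [InnerProductSpace ℝ S]
  [NormedAddCommGroup M] [InnerProductSpace ℝ M]
  [NormedAddCommGroup H] [InnerProductSpace ℝ H]

/-- The standing hypotheses on the spaces `M ⊆ H ⊆ M*` (the first inclusion is `j`) and on the
continuous bilinear forms `a` on `S × S` and `b` on `S × M`: `a` is symmetric, positive definite,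
and elliptic on the kernel of `b`; `b` satisfies the inf-sup condition
(`‖b.flip v‖` is the supremum of `b(τ, v) / ‖τ‖` over `τ ≠ 0`). -/
structure IsMixedSetting (j : M →L[ℝ] H) (a : S →L[ℝ] S →L[ℝ] ℝ) (b : S →L[ℝ] M →L[ℝ] ℝ) :
    Prop where
  embedding_injective : Function.Injective j
  embedding_dense : DenseRange j
  symm : ∀ σ τ : S, a σ τ = a τ σ
  pos : ∀ τ : S, τ ≠ 0 → 0 < a τ τ
  elliptic : ∃ α : ℝ, 0 < α ∧ ∀ τ : S, (∀ v : M, b τ v = 0) → α * ‖τ‖ ^ 2 ≤ a τ τ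
  inf_sup : ∃ β : ℝ, 0 < β ∧ ∀ v : M, β * ‖v‖ ≤ ‖b.flip v‖

/-- The norm `|τ|_a` associated with `a`. -/
def normA (a : S →L[ℝ] S →L[ℝ] ℝ) (τ : S) : ℝ := Real.sqrt (a τ τ)

/-- `(σ, u) ∈ Sh × Mh` solves the mixed source problem with datum `g` on the pair `(Sh, Mh)`.
The continuous problem is the case `Sh = ⊤`, `Mh = ⊤`. -/
def IsSourceSolution (j : M →L[ℝ] H) (a : S →L[ℝ] S →L[ℝ] ℝ) (b : S →L[ℝ] M →L[ℝ] ℝ)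
    (Sh : Submodule ℝ S) (Mh : Submodule ℝ M) (g : H) (σ : S) (u : M) : Prop :=
  σ ∈ Sh ∧ u ∈ Mh ∧ (∀ τ ∈ Sh, a σ τ + b τ u = 0) ∧ ∀ v ∈ Mh, b σ v = -⟪g, j v⟫

/-- The mixed eigenvalue equations (without normalization) for `(lam, σ, u)` on `(Sh, Mh)`. -/
def IsEigenSolution (j : M →L[ℝ] H) (a : S →L[ℝ] S →L[ℝ] ℝ) (b : S →L[ℝ] M →L[ℝ] ℝ)
    (Sh : Submodule ℝ S) (Mh : Submodule ℝ M) (lam : ℝ) (σ : S) (u : M) : Prop :=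
  σ ∈ Sh ∧ u ∈ Mh ∧ (∀ τ ∈ Sh, a σ τ + b τ u = 0) ∧ ∀ v ∈ Mh, b σ v = -lam * ⟪j u, j v⟫

open Classical in
/-- The pair of solution operators `g ↦ (A g, T g)` on `(Sh, Mh)`: the linear map that sends every
datum to a solution of the source problem (zero if there is no such map; see `WellPosed`). -/
def solutionPair (j : M →L[ℝ] H) (a : S →L[ℝ] S →L[ℝ] ℝ) (b : S →L[ℝ] M →L[ℝ] ℝ)
    (Sh : Submodule ℝ S) (Mh : Submodule ℝ M) : H →ₗ[ℝ] S × M :=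
  if h : ∃ P : H →ₗ[ℝ] S × M, ∀ g, IsSourceSolution j a b Sh Mh g (P g).1 (P g).2 then
    Classical.choose h
  else 0

/-- The solution operator `A` (`A_h` for a discrete pair). -/
def solA (j : M →L[ℝ] H) (a : S →L[ℝ] S →L[ℝ] ℝ) (b : S →L[ℝ] M →L[ℝ] ℝ)
    (Sh : Submodule ℝ S) (Mh : Submodule ℝ M) : H →ₗ[ℝ] S :=
  LinearMap.fst ℝ S M ∘ₗ solutionPair j a b Sh Mh

/-- The solution operator `T` (`T_h` for a discrete pair), with values in `M`. -/
def solT (j : M →L[ℝ] H) (a : S →L[ℝ] S →L[ℝ] ℝ) (b : S →L[ℝ] M →L[ℝ] ℝ)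
    (Sh : Submodule ℝ S) (Mh : Submodule ℝ M) : H →ₗ[ℝ] M :=
  LinearMap.snd ℝ S M ∘ₗ solutionPair j a b Sh Mh

/-- The solution operator `T` (or `T_h`), regarded as an operator from `H` into itself. -/
def solTH (j : M →L[ℝ] H) (a : S →L[ℝ] S →L[ℝ] ℝ) (b : S →L[ℝ] M →L[ℝ] ℝ)
    (Sh : Submodule ℝ S) (Mh : Submodule ℝ M) : H →ₗ[ℝ] H :=
  (j : M →ₗ[ℝ] H) ∘ₗ solT j a b Sh Mh

/-- For each datum `g` the source problem has exactly one solution, and it is `(A g, T g)`. -/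
def WellPosed (j : M →L[ℝ] H) (a : S →L[ℝ] S →L[ℝ] ℝ) (b : S →L[ℝ] M →L[ℝ] ℝ)
    (Sh : Submodule ℝ S) (Mh : Submodule ℝ M) : Prop :=
  ∀ (g : H) (σ : S) (u : M), IsSourceSolution j a b Sh Mh g σ u ↔
    σ = solA j a b Sh Mh g ∧ u = solT j a b Sh Mh g

/-- An enumeration, by an ordered index type, of all the eigenvalues on `(Sh, Mh)` in nondecreasing
order and repeated according to multiplicity, with eigenfunctions orthonormal in `H`. -/
structure IsEigensystem {I : Type*} [Preorder I] (j : M →L[ℝ] H) (a : S →L[ℝ] S →L[ℝ] ℝ)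
    (b : S →L[ℝ] M →L[ℝ] ℝ) (Sh : Submodule ℝ S) (Mh : Submodule ℝ M)
    (lam : I → ℝ) (sig : I → S) (u : I → M) : Prop where
  pos : ∀ i, 0 < lam i
  mono : Monotone lam
  orthonormal : Orthonormal ℝ (fun i => j (u i))
  eigen : ∀ i, IsEigenSolution j a b Sh Mh (lam i) (sig i) (u i)
  complete : ∀ (μ : ℝ) (σ : S) (v : M), IsEigenSolution j a b Sh Mh μ σ v →
    v ∈ Submodule.span ℝ (u '' {i | lam i = μ})

/-- `(Sh, Mh)` is a discretization with approximation constant `ρ`: finite-dimensional spaces,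
the commuting diagram relation `B(Sh) = Mh` (where `b(τ, v) = (Bτ, v)_H`), the Fortid condition and
the strong approximability; solutions of the source problem with datum `g` are measured by the
norm of `g`. -/
structure IsDiscretization (j : M →L[ℝ] H) (a : S →L[ℝ] S →L[ℝ] ℝ) (b : S →L[ℝ] M →L[ℝ] ℝ)
    (Sh : Submodule ℝ S) (Mh : Submodule ℝ M) (ρ : ℝ) : Prop where
  finite_S : FiniteDimensional ℝ Sh
  finite_M : FiniteDimensional ℝ Mh
  image_subset : ∀ τ ∈ Sh, ∃ w ∈ Mh, ∀ v : M, b τ v = ⟪j w, j v⟫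
  subset_image : ∀ w ∈ Mh, ∃ τ ∈ Sh, ∀ v : M, b τ v = ⟪j w, j v⟫
  fortid : ∀ (g : H) (σ : S) (u : M), IsSourceSolution j a b ⊤ ⊤ g σ u →
    ∃ σh ∈ Sh, (∀ v ∈ Mh, b (σ - σh) v = 0) ∧ normA a (σ - σh) ≤ ρ * ‖g‖
  strong_approx : ∀ (g : H) (σ : S) (u : M), IsSourceSolution j a b ⊤ ⊤ g σ u →
    (⨅ v : Mh, ‖j u - j (v : M)‖) ≤ ρ * ‖g‖

/-- The span of the eigenfunctions whose index lies in `J`. -/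
def clusterSpace {I : Type*} (u : I → M) (J : Set I) : Submodule ℝ M :=
  Submodule.span ℝ (u '' J)

instance clusterSpace_finiteDimensional {I : Type*} (u : I → M) (J : Set I) [Finite J] :
    FiniteDimensional ℝ (clusterSpace u J) :=
  FiniteDimensional.span_of_finite ℝ ((Set.toFinite J).image u)

/-- A subspace of `M`, regarded as a subspace of `H`. -/
abbrev inH (j : M →L[ℝ] H) (W : Submodule ℝ M) : Submodule ℝ H := W.map (j : M →ₗ[ℝ] H)

open Classical in
/-- `G(w)` (`G_h(w)` for a discrete space `Sh`): the `σ ∈ Sh` with `a(σ, τ) + b(τ, w) = 0` for all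
`τ ∈ Sh`, if it exists. -/
def G (a : S →L[ℝ] S →L[ℝ] ℝ) (b : S →L[ℝ] M →L[ℝ] ℝ) (Sh : Submodule ℝ S) (w : M) : S :=
  if h : ∃ σ ∈ Sh, ∀ τ ∈ Sh, a σ τ + b τ w = 0 then Classical.choose h else 0

/-- The distance `d(u, v)` of a continuous function `u` and a discrete function `v`. -/
def mixedDist (j : M →L[ℝ] H) (a : S →L[ℝ] S →L[ℝ] ℝ) (b : S →L[ℝ] M →L[ℝ] ℝ)
    (Sh : Submodule ℝ S) (u v : M) : ℝ :=
  Real.sqrt (‖j u - j v‖ ^ 2 + normA a (G a b ⊤ u - G a b Sh v) ^ 2)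

/-- The gap `δ(W, Wh)`. -/
def gap (j : M →L[ℝ] H) (a : S →L[ℝ] S →L[ℝ] ℝ) (b : S →L[ℝ] M →L[ℝ] ℝ)
    (Sh : Submodule ℝ S) (W Wh : Submodule ℝ M) : ℝ :=
  ⨆ u : {u : M // u ∈ W ∧ ‖j u‖ = 1}, ⨅ v : Wh, mixedDist j a b Sh (u : M) (v : M)

/-- `F_h : W → Wh`, the restriction to `W` of the `H`-orthogonal projection onto `Wh`. -/
def projF (W Wh : Submodule ℝ H) [FiniteDimensional ℝ Wh] : W →ₗ[ℝ] Wh :=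
  (Wh.orthogonalProjectionOnto : H →ₗ[ℝ] Wh) ∘ₗ W.subtype

/-- `F_h⁻¹ T_h F_h : W → W`, for `T_h` leaving `Wh` invariant and bijective `F_h`. -/
def hatTh (Th : H →ₗ[ℝ] H) (W Wh : Submodule ℝ H) [FiniteDimensional ℝ Wh]
    (hTh : ∀ x ∈ Wh, Th x ∈ Wh) (hF : Function.Bijective (projF W Wh)) : W →ₗ[ℝ] W :=
  ((LinearEquiv.ofBijective (projF W Wh) hF).symm : Wh →ₗ[ℝ] W) ∘ₗ
    Th.restrict hTh ∘ₗ projF W Wh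

/-- The operators `T|_W` and `F_h⁻¹ T_h F_h` from `W` into itself are well defined, and their
distance in the operator norm induced by the norm of `H` is at most `ε`. -/
def HatEstimate (T Th : H →ₗ[ℝ] H) (W Wh : Submodule ℝ H) [FiniteDimensional ℝ W]
    [FiniteDimensional ℝ Wh] (ε : ℝ) : Prop :=
  ∃ (hT : ∀ x ∈ W, T x ∈ W) (hTh : ∀ x ∈ Wh, Th x ∈ Wh) (hF : Function.Bijective (projF W Wh)),
    ‖LinearMap.toContinuousLinearMap (T.restrict hT - hatTh Th W Wh hTh hF)‖ ≤ ε

end MixedEVP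

end

/-!
On `W` the operator `F T - T_h F` measures `T - F⁻¹ T_h F`, and its values lie in `W_h`. Tested
against `w ∈ W_h`, it equals `a(A_h w, A x - σ)` up to the projection error of the data, for every
interpolant `σ` of the flux `A x` (same image under `b` on `M_h`). Writing `w` in terms of `F`, the
leading parts cancel and every remaining term is a product of two first-order errors; a crude bound
with the Fortin interpolant first shows that the discrete flux `A_h x` is accurate to order
`δ(W, W_h)`, and inserting `σ = A_h x` then yields order `δ(W, W_h) ^ 2`. The assumption
`δ(W, W_h) ≤ θ < 1` makes `F` bijective, because the dimension of `W_h` is at most that of `W`, and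
it bounds the discrete eigenvalues of the cluster through the energy part of the gap.

For a separated cluster, duality gives `T_h → T` in norm at the rate `ρ`. Weyl's inequality then
keeps the remaining discrete eigenvalues away from those of the cluster, so the projections of the
eigenfunctions of `W` onto `W_h` converge and the gap tends to zero.
-/

noncomputable section

namespace MixedEVP

variable {S M H : Type*}
  [NormedAddCommGroup S] [InnerProductSpace ℝ S]
  [NormedAddCommGroup M] [InnerProductSpace ℝ M]
  [NormedAddCommGroup H] [InnerProductSpace ℝ H]
  {j : M →L[ℝ] H} {a : S →L[ℝ] S →L[ℝ] ℝ} {b : S →L[ℝ] M →L[ℝ] ℝ}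
  {Sh : Submodule ℝ S} {Mh : Submodule ℝ M}

lemma le_of_sq_le_mul {x y : ℝ} (hy : 0 ≤ y) (h : x ^ 2 ≤ y * x) : x ≤ y := by
  by_contra! hlt
  nlinarith

/-- A symmetric and positive definite continuous bilinear form: the part of `IsMixedSetting` that
makes `normA a` a norm. -/
structure IsEnergyForm (a : S →L[ℝ] S →L[ℝ] ℝ) : Prop where
  symm : ∀ σ τ : S, a σ τ = a τ σ
  pos : ∀ τ : S, τ ≠ 0 → 0 < a τ τ

lemma IsMixedSetting.isEnergyForm (hs : IsMixedSetting j a b) : IsEnergyForm a :=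
  ⟨hs.symm, hs.pos⟩

lemma normA_nonneg (τ : S) : 0 ≤ normA a τ := Real.sqrt_nonneg _

lemma normA_smul (c : ℝ) (τ : S) : normA a (c • τ) = |c| * normA a τ := by
  simp only [normA, map_smul, smul_apply, smul_eq_mul]
  rw [← mul_assoc, Real.sqrt_mul (mul_self_nonneg c), Real.sqrt_mul_self_eq_abs]

lemma normA_neg (τ : S) : normA a (-τ) = normA a τ := by simp [normA]

lemma normA_sub_comm (σ τ : S) : normA a (σ - τ) = normA a (τ - σ) := by
  rw [← normA_neg, neg_sub]

namespace IsEnergyForm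

lemma self_nonneg (ha : IsEnergyForm a) (τ : S) : 0 ≤ a τ τ := by
  rcases eq_or_ne τ 0 with rfl | hτ
  · simp
  · exact (ha.pos τ hτ).le

lemma eq_zero_of_self (ha : IsEnergyForm a) {τ : S} (h : a τ τ = 0) : τ = 0 := by
  by_contra hτ
  exact (ha.pos τ hτ).ne' h

lemma normA_sq (ha : IsEnergyForm a) (τ : S) : normA a τ ^ 2 = a τ τ :=
  Real.sq_sqrt (ha.self_nonneg τ)

lemma abs_apply_le (ha : IsEnergyForm a) (σ τ : S) : |a σ τ| ≤ normA a σ * normA a τ := by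
  refine abs_le_of_sq_le_sq ?_ (mul_nonneg (normA_nonneg σ) (normA_nonneg τ))
  rw [mul_pow, ha.normA_sq, ha.normA_sq]
  exact LinearMap.BilinForm.apply_sq_le_of_symm (ContinuousLinearMap.toLinearMap₁₂ a)
    ha.self_nonneg ⟨ha.symm⟩ σ τ

lemma apply_le (ha : IsEnergyForm a) (σ τ : S) : a σ τ ≤ normA a σ * normA a τ :=
  (le_abs_self _).trans (ha.abs_apply_le σ τ)

lemma normA_add_sq (ha : IsEnergyForm a) (σ τ : S) :
    normA a (σ + τ) ^ 2 = normA a σ ^ 2 + 2 * a σ τ + normA a τ ^ 2 := by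
  simp only [ha.normA_sq, map_add, add_apply, ha.symm τ σ]
  ring

lemma normA_add_le (ha : IsEnergyForm a) (σ τ : S) :
    normA a (σ + τ) ≤ normA a σ + normA a τ := by
  refine le_of_sq_le_sq ?_ (add_nonneg (normA_nonneg σ) (normA_nonneg τ))
  rw [ha.normA_add_sq, add_sq]
  linarith [ha.apply_le σ τ]

lemma normA_sub_le (ha : IsEnergyForm a) (σ τ υ : S) :
    normA a (σ - υ) ≤ normA a (σ - τ) + normA a (τ - υ) := by
  simpa only [sub_add_sub_cancel] using ha.normA_add_le (σ - τ) (τ - υ)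

lemma normA_le_add_sub (ha : IsEnergyForm a) (σ τ : S) :
    normA a σ ≤ normA a τ + normA a (σ - τ) := by
  simpa only [add_sub_cancel] using ha.normA_add_le τ (σ - τ)

lemma normA_le_normA_add_of_orthogonal (ha : IsEnergyForm a) {σ τ : S} (h : a σ τ = 0) :
    normA a σ ≤ normA a (σ + τ) := by
  refine le_of_sq_le_sq ?_ (normA_nonneg _)
  rw [ha.normA_add_sq, h]
  linarith [sq_nonneg (normA a τ)]

lemma G_eq (ha : IsEnergyForm a) {σ : S} {w : M} (hσ : σ ∈ Sh)
    (h : ∀ τ ∈ Sh, a σ τ + b τ w = 0) : G a b Sh w = σ := by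
  have hex : ∃ σ ∈ Sh, ∀ τ ∈ Sh, a σ τ + b τ w = 0 := ⟨σ, hσ, h⟩
  obtain ⟨hmem, heq⟩ := Classical.choose_spec hex
  rw [G, dif_pos hex]
  set σ' := Classical.choose hex
  refine sub_eq_zero.1 (ha.eq_zero_of_self ?_)
  have hdiff : σ' - σ ∈ Sh := Sh.sub_mem hmem hσ
  rw [map_sub a, sub_apply]
  linarith [h _ hdiff, heq _ hdiff]

end IsEnergyForm

namespace IsSourceSolution

variable {g g' : H} {σ σ' : S} {u u' : M}

lemma add (h : IsSourceSolution j a b Sh Mh g σ u) (h' : IsSourceSolution j a b Sh Mh g' σ' u') :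
    IsSourceSolution j a b Sh Mh (g + g') (σ + σ') (u + u') := by
  obtain ⟨hσ, hu, hτ, hv⟩ := h
  obtain ⟨hσ', hu', hτ', hv'⟩ := h'
  refine ⟨Sh.add_mem hσ hσ', Mh.add_mem hu hu', fun τ hmem => ?_, fun v hmem => ?_⟩
  · simp only [map_add, add_apply]
    linarith [hτ τ hmem, hτ' τ hmem]
  · simp only [map_add, add_apply, inner_add_left]
    linarith [hv v hmem, hv' v hmem]

lemma smul (c : ℝ) (h : IsSourceSolution j a b Sh Mh g σ u) :
    IsSourceSolution j a b Sh Mh (c • g) (c • σ) (c • u) := by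
  obtain ⟨hσ, hu, hτ, hv⟩ := h
  refine ⟨Sh.smul_mem c hσ, Mh.smul_mem c hu, fun τ hmem => ?_, fun v hmem => ?_⟩
  · simp only [map_smul, smul_apply, smul_eq_mul]
    rw [← mul_add, hτ τ hmem, mul_zero]
  · simp only [map_smul, smul_apply, smul_eq_mul, real_inner_smul_left, hv v hmem]
    ring

lemma eq_zero (ha : IsEnergyForm a) (hb : ∀ v ∈ Mh, (∀ τ ∈ Sh, b τ v = 0) → v = 0)
    (h : IsSourceSolution j a b Sh Mh 0 σ u) : σ = 0 ∧ u = 0 := by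
  obtain ⟨hσ, hu, hτ, hv⟩ := h
  have hσ0 : σ = 0 := ha.eq_zero_of_self (by simpa [hv u hu] using hτ σ hσ)
  exact ⟨hσ0, hb u hu fun τ hmem => by simpa [hσ0] using hτ τ hmem⟩

end IsSourceSolution

theorem wellPosed_of_exists_of_unique
    (hex : ∀ g : H, ∃ (σ : S) (u : M), IsSourceSolution j a b Sh Mh g σ u)
    (huniq : ∀ (σ : S) (u : M), IsSourceSolution j a b Sh Mh 0 σ u → σ = 0 ∧ u = 0) :
    WellPosed j a b Sh Mh := by
  have hunique {g : H} {p q : S × M} (hp : IsSourceSolution j a b Sh Mh g p.1 p.2)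
      (hq : IsSourceSolution j a b Sh Mh g q.1 q.2) : p = q := by
    have hdiff := huniq _ _ (by simpa using hp.add (hq.smul (-1)))
    ext
    · simpa [← sub_eq_add_neg, sub_eq_zero] using hdiff.1
    · simpa [← sub_eq_add_neg, sub_eq_zero] using hdiff.2
  choose σ u hσu using hex
  have hlin : ∃ P : H →ₗ[ℝ] S × M, ∀ g, IsSourceSolution j a b Sh Mh g (P g).1 (P g).2 :=
    ⟨{ toFun := fun g => (σ g, u g)
       map_add' := fun g g' => hunique (hσu (g + g')) ((hσu g).add (hσu g'))
       map_smul' := fun c g => hunique (hσu (c • g)) ((hσu g).smul c) }, hσu⟩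
  have hsol (g : H) :
      IsSourceSolution j a b Sh Mh g (solA j a b Sh Mh g) (solT j a b Sh Mh g) := by
    simpa [solA, solT, solutionPair, dif_pos hlin] using Classical.choose_spec hlin g
  refine fun g σ' u' => ⟨fun h => ?_, ?_⟩
  · exact Prod.mk.inj (hunique (p := (σ', u'))
      (q := (solA j a b Sh Mh g, solT j a b Sh Mh g)) h (hsol g))
  · rintro ⟨rfl, rfl⟩
    exact hsol g

section Brezzi

variable [CompleteSpace S]

/-- The operator `M → S` that represents `b` through the Riesz isomorphism of `S`; its range is the
orthogonal complement of the kernel of `b` once the inf-sup condition makes it closed. -/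
def rieszB (b : S →L[ℝ] M →L[ℝ] ℝ) : M →L[ℝ] S :=
  LinearMap.mkContinuous
    { toFun := fun v => (InnerProductSpace.toDual ℝ S).symm (b.flip v)
      map_add' := fun v w => by simp
      map_smul' := fun c v => by simp } ‖b.flip‖ (fun v => by
        simpa using b.flip.le_opNorm v)

lemma inner_rieszB (v : M) (τ : S) : ⟪rieszB b v, τ⟫ = b τ v := by
  simp [rieszB]

lemma norm_rieszB (v : M) : ‖rieszB b v‖ = ‖b.flip v‖ := by
  simp [rieszB]

lemma isClosed_range_rieszB [CompleteSpace M] {β : ℝ} (hβ : 0 < β)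
    (hb : ∀ v : M, β * ‖v‖ ≤ ‖b.flip v‖) : IsClosed ((rieszB b).range : Set S) := by
  have hanti : AntilipschitzWith (β⁻¹).toNNReal (rieszB b) := by
    refine ContinuousLinearMap.antilipschitz_of_bound _ fun v => ?_
    rw [Real.coe_toNNReal _ (inv_nonneg.2 hβ.le), norm_rieszB, inv_mul_eq_div,
      le_div_iff₀ hβ, mul_comm]
    exact hb v
  exact hanti.isClosed_range (rieszB b).uniformContinuous

lemma exists_multiplier [CompleteSpace M] {β : ℝ} (hβ : 0 < β)
    (hb : ∀ v : M, β * ‖v‖ ≤ ‖b.flip v‖) (f : S →L[ℝ] ℝ)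
    (hf : ∀ τ, (∀ v, b τ v = 0) → f τ = 0) : ∃ u : M, ∀ τ, f τ + b τ u = 0 := by
  have := (isClosed_range_rieszB hβ hb).completeSpace_coe
  obtain ⟨u, hu⟩ : (InnerProductSpace.toDual ℝ S).symm f ∈ (rieszB b).range := by
    rw [← (rieszB b).range.orthogonal_orthogonal, Submodule.mem_orthogonal']
    intro τ hτ
    rw [InnerProductSpace.toDual_symm_apply]
    exact hf τ fun v => (inner_rieszB v τ).symm.trans (hτ _ ⟨v, rfl⟩)
  refine ⟨-u, fun τ => ?_⟩
  have hτ : b τ u = f τ := by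
    rw [← inner_rieszB, ← InnerProductSpace.toDual_symm_apply]
    exact congrArg (⟪·, τ⟫) hu
  simp [hτ]

lemma exists_forall_b_eq [CompleteSpace M] {β : ℝ} (hβ : 0 < β)
    (hb : ∀ v : M, β * ‖v‖ ≤ ‖b.flip v‖) (f : M →L[ℝ] ℝ) : ∃ σ : S, ∀ v, b σ v = f v := by
  have hcoercive : IsCoercive (b ∘L rieszB b) := by
    refine ⟨β ^ 2, by positivity, fun v => ?_⟩
    calc β ^ 2 * ‖v‖ * ‖v‖ = (β * ‖v‖) ^ 2 := by ring
      _ ≤ ‖rieszB b v‖ ^ 2 := by rw [norm_rieszB]; gcongr; exact hb v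
      _ = b (rieszB b v) v := by rw [← real_inner_self_eq_norm_sq, inner_rieszB]
  refine ⟨rieszB b (hcoercive.continuousLinearEquivOfBilin.symm
    ((InnerProductSpace.toDual ℝ M).symm f)), fun v => ?_⟩
  change (b ∘L rieszB b) _ v = f v
  rw [← hcoercive.continuousLinearEquivOfBilin_apply]
  simp

lemma exists_kernel_solution {α : ℝ} (hα : 0 < α)
    (hell : ∀ τ : S, (∀ v : M, b τ v = 0) → α * ‖τ‖ ^ 2 ≤ a τ τ) (f : S →L[ℝ] ℝ) :
    ∃ σ : S, (∀ v, b σ v = 0) ∧ ∀ τ, (∀ v, b τ v = 0) → a σ τ = f τ := by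
  let K : Submodule ℝ S := b.ker
  have := b.isClosed_ker.completeSpace_coe
  have hK (τ : S) : τ ∈ K ↔ ∀ v, b τ v = 0 := by
    simp [K, ContinuousLinearMap.ext_iff]
  let aK : K →L[ℝ] K →L[ℝ] ℝ := a.bilinearComp K.subtypeL K.subtypeL
  have hcoercive : IsCoercive aK :=
    ⟨α, hα, fun τ => by simpa [aK, pow_two, mul_assoc] using hell τ ((hK τ).1 τ.2)⟩
  let σ : K := hcoercive.continuousLinearEquivOfBilin.symm
    ((InnerProductSpace.toDual ℝ K).symm (f ∘L K.subtypeL))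
  refine ⟨σ, (hK σ).1 σ.2, fun τ hτ => ?_⟩
  change aK σ ⟨τ, (hK τ).2 hτ⟩ = f τ
  rw [← hcoercive.continuousLinearEquivOfBilin_apply]
  simp [σ]

theorem IsMixedSetting.wellPosed [CompleteSpace M] (hs : IsMixedSetting j a b) :
    WellPosed j a b ⊤ ⊤ := by
  obtain ⟨α, hα, hell⟩ := hs.elliptic
  obtain ⟨β, hβ, hinfsup⟩ := hs.inf_sup
  refine wellPosed_of_exists_of_unique (fun g => ?_) fun σ u => ?_
  · obtain ⟨σ₀, hσ₀⟩ := exists_forall_b_eq hβ hinfsup (-(innerSL ℝ g ∘L j))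
    obtain ⟨σ₁, hσ₁, hker⟩ := exists_kernel_solution hα hell (-a σ₀)
    obtain ⟨u, hu⟩ := exists_multiplier hβ hinfsup (a (σ₀ + σ₁)) fun τ hτ => by
      rw [map_add, add_apply, hker τ hτ, neg_apply, add_neg_cancel]
    exact ⟨σ₀ + σ₁, u, trivial, trivial, fun τ _ => hu τ, fun v _ => by simp [hσ₀, hσ₁]⟩
  · refine IsSourceSolution.eq_zero hs.isEnergyForm fun v _ hv => ?_
    have hflip : b.flip v = 0 := ContinuousLinearMap.ext fun τ => hv τ trivial
    have hle := hinfsup v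
    rw [hflip, norm_zero] at hle
    exact norm_le_zero_iff.1 (nonpos_of_mul_nonpos_right hle hβ)

end Brezzi

lemma exists_isSourceSolution_of_finiteDimensional [FiniteDimensional ℝ Sh]
    [FiniteDimensional ℝ Mh]
    (huniq : ∀ (σ : S) (u : M), IsSourceSolution j a b Sh Mh 0 σ u → σ = 0 ∧ u = 0) (g : H) :
    ∃ (σ : S) (u : M), IsSourceSolution j a b Sh Mh g σ u := by
  let L : Sh × Mh →ₗ[ℝ] Module.Dual ℝ Sh × Module.Dual ℝ Mh :=
    { toFun := fun p => ((((a (p.1 : S)) + b.flip (p.2 : M)) : S →ₗ[ℝ] ℝ) ∘ₗ Sh.subtype,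
        (b (p.1 : S) : M →ₗ[ℝ] ℝ) ∘ₗ Mh.subtype)
      map_add' := fun p q => by ext <;> simp; ring
      map_smul' := fun c p => by ext <;> simp; ring }
  have hinj : Function.Injective L := by
    rw [← LinearMap.ker_eq_bot, LinearMap.ker_eq_bot']
    rintro ⟨σ, u⟩ hL
    obtain ⟨hσ, hu⟩ := huniq σ u ⟨σ.2, u.2,
      fun τ hτ => LinearMap.congr_fun (congrArg Prod.fst hL) ⟨τ, hτ⟩,
      fun v hv => by
        rw [inner_zero_left, neg_zero]
        exact LinearMap.congr_fun (congrArg Prod.snd hL) ⟨v, hv⟩⟩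
    ext <;> simp [hσ, hu]
  have hsurj : Function.Surjective L :=
    (LinearMap.injective_iff_surjective_of_finrank_eq_finrank (by
      simp [Module.finrank_prod, Subspace.dual_finrank_eq])).1 hinj
  obtain ⟨⟨σ, u⟩, hL⟩ := hsurj (0, -((innerSL ℝ g ∘L j : M →L[ℝ] ℝ) : M →ₗ[ℝ] ℝ) ∘ₗ Mh.subtype)
  exact ⟨σ, u, σ.2, u.2,
    fun τ hτ => LinearMap.congr_fun (congrArg Prod.fst hL) ⟨τ, hτ⟩,
    fun v hv => LinearMap.congr_fun (congrArg Prod.snd hL) ⟨v, hv⟩⟩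

namespace IsDiscretization

variable {ρ : ℝ}

lemma b_eq_zero (hd : IsDiscretization j a b Sh Mh ρ) {τ : S} (hτ : τ ∈ Sh)
    (h : ∀ v ∈ Mh, b τ v = 0) (v : M) : b τ v = 0 := by
  obtain ⟨w, hw, hb⟩ := hd.image_subset τ hτ
  have hjw : j w = 0 := inner_self_eq_zero.1 ((hb w).symm.trans (h w hw))
  rw [hb, hjw, inner_zero_left]

theorem wellPosed (hd : IsDiscretization j a b Sh Mh ρ) (ha : IsEnergyForm a)
    (hj : Function.Injective j) : WellPosed j a b Sh Mh := by
  have := hd.finite_S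
  have := hd.finite_M
  have huniq (σ : S) (u : M) (h : IsSourceSolution j a b Sh Mh 0 σ u) : σ = 0 ∧ u = 0 := by
    refine h.eq_zero ha fun v hv hb => ?_
    obtain ⟨τ, hτ, hτv⟩ := hd.subset_image v hv
    have hjv : j v = 0 := inner_self_eq_zero.1 ((hτv v).symm.trans (hb τ hτ))
    exact (map_eq_zero_iff j hj).1 hjv
  exact wellPosed_of_exists_of_unique (exists_isSourceSolution_of_finiteDimensional huniq) huniq

end IsDiscretization

namespace WellPosed

lemma source (hw : WellPosed j a b Sh Mh) (g : H) :
    IsSourceSolution j a b Sh Mh g (solA j a b Sh Mh g) (solT j a b Sh Mh g) :=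
  (hw g _ _).2 ⟨rfl, rfl⟩

lemma solA_mem (hw : WellPosed j a b Sh Mh) (g : H) : solA j a b Sh Mh g ∈ Sh :=
  (hw.source g).1

lemma solT_mem (hw : WellPosed j a b Sh Mh) (g : H) : solT j a b Sh Mh g ∈ Mh :=
  (hw.source g).2.1

lemma range_solT_le (hw : WellPosed j a b Sh Mh) : LinearMap.range (solT j a b Sh Mh) ≤ Mh := by
  rintro _ ⟨g, rfl⟩
  exact hw.solT_mem g

lemma a_solA_left (hw : WellPosed j a b Sh Mh) (g : H) {τ : S} (hτ : τ ∈ Sh) :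
    a (solA j a b Sh Mh g) τ = -b τ (solT j a b Sh Mh g) :=
  eq_neg_of_add_eq_zero_left ((hw.source g).2.2.1 τ hτ)

lemma b_solA (hw : WellPosed j a b Sh Mh) (g : H) {v : M} (hv : v ∈ Mh) :
    b (solA j a b Sh Mh g) v = -⟪g, j v⟫ :=
  (hw.source g).2.2.2 v hv

lemma a_solA (hw : WellPosed j a b Sh Mh) (f g : H) :
    a (solA j a b Sh Mh f) (solA j a b Sh Mh g) = ⟪g, solTH j a b Sh Mh f⟫ := by
  rw [hw.a_solA_left f (hw.solA_mem g), hw.b_solA g (hw.solT_mem f), neg_neg]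
  rfl

lemma isSymmetric_solTH (hw : WellPosed j a b Sh Mh) (ha : IsEnergyForm a) :
    (solTH j a b Sh Mh).IsSymmetric := fun f g => by
  rw [real_inner_comm, ← hw.a_solA, ← hw.a_solA, ha.symm]

lemma G_solT (hw : WellPosed j a b Sh Mh) (ha : IsEnergyForm a) (g : H) :
    G a b Sh (solT j a b Sh Mh g) = solA j a b Sh Mh g :=
  ha.G_eq (hw.solA_mem g) (hw.source g).2.2.1

lemma G_smul (hw : WellPosed j a b Sh Mh) (ha : IsEnergyForm a) (c : ℝ) {w : M}
    (h : w ∈ LinearMap.range (solT j a b Sh Mh)) : G a b Sh (c • w) = c • G a b Sh w := by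
  obtain ⟨g, rfl⟩ := h
  rw [← map_smul, hw.G_solT ha, hw.G_solT ha, map_smul]

lemma G_sub (hw : WellPosed j a b Sh Mh) (ha : IsEnergyForm a) {v w : M}
    (hv : v ∈ LinearMap.range (solT j a b Sh Mh)) (h : w ∈ LinearMap.range (solT j a b Sh Mh)) :
    G a b Sh (v - w) = G a b Sh v - G a b Sh w := by
  obtain ⟨f, rfl⟩ := hv
  obtain ⟨g, rfl⟩ := h
  rw [← map_sub, hw.G_solT ha, hw.G_solT ha, hw.G_solT ha, map_sub]

lemma norm_solTH_le (hw : WellPosed j a b Sh Mh) (ha : IsEnergyForm a) {K : ℝ}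
    (hK : ∀ g : H, normA a (solA j a b Sh Mh g) ≤ K * ‖g‖) (g : H) :
    ‖solTH j a b Sh Mh g‖ ≤ K ^ 2 * ‖g‖ := by
  set f := solTH j a b Sh Mh g with hf
  refine le_of_sq_le_mul (by positivity) ?_
  calc ‖f‖ ^ 2 = a (solA j a b Sh Mh g) (solA j a b Sh Mh f) := by
        rw [hw.a_solA, ← hf, real_inner_self_eq_norm_sq]
    _ ≤ (K * ‖g‖) * (K * ‖f‖) := (ha.apply_le _ _).trans
        (mul_le_mul (hK g) (hK f) (normA_nonneg _) ((normA_nonneg _).trans (hK g)))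
    _ = K ^ 2 * ‖g‖ * ‖f‖ := by ring

lemma solT_injective (hw : WellPosed j a b Sh ⊤) (ha : IsEnergyForm a) (hj : DenseRange j) :
    Function.Injective (solT j a b Sh ⊤) := by
  refine (injective_iff_map_eq_zero _).2 fun g hg => ?_
  have hA : solA j a b Sh ⊤ g = 0 := ha.eq_zero_of_self (by
    rw [hw.a_solA, solTH, LinearMap.comp_apply, hg, map_zero, inner_zero_right])
  exact hj.eq_zero_of_inner_left ℝ fun v => by simpa [hA] using hw.b_solA g (v := v) trivial

/- Being symmetric and defined on all of `H`, the operator `T` is bounded by the Hellinger–Toeplitz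
theorem, and `|A g|_a ^ 2 = (g, T g)`. -/
lemma exists_normA_solA_le [CompleteSpace H] (hw : WellPosed j a b Sh Mh) (ha : IsEnergyForm a) :
    ∃ K : ℝ, 0 ≤ K ∧ ∀ g : H, normA a (solA j a b Sh Mh g) ≤ K * ‖g‖ := by
  let T : H →L[ℝ] H := ⟨solTH j a b Sh Mh, (hw.isSymmetric_solTH ha).continuous⟩
  refine ⟨Real.sqrt ‖T‖, Real.sqrt_nonneg _, fun g => ?_⟩
  refine le_of_sq_le_sq ?_ (by positivity)
  calc normA a (solA j a b Sh Mh g) ^ 2 = ⟪g, T g⟫ := by rw [ha.normA_sq, hw.a_solA]; rfl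
    _ ≤ ‖g‖ * (‖T‖ * ‖g‖) := (real_inner_le_norm _ _).trans (by gcongr; exact T.le_opNorm g)
    _ = (Real.sqrt ‖T‖ * ‖g‖) ^ 2 := by rw [mul_pow, Real.sq_sqrt (norm_nonneg _)]; ring

end WellPosed

/-- `σh ∈ Sh` is a Fortin interpolant of `σ`: the functional `b (σ - σh)` vanishes on `Mh`. Both the
element provided by the Fortid condition and the discrete solution `A_h g` are interpolants of
`A g`. -/
def IsInterpolant (b : S →L[ℝ] M →L[ℝ] ℝ) (Sh : Submodule ℝ S) (Mh : Submodule ℝ M) (σ σh : S) :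
    Prop :=
  σh ∈ Sh ∧ ∀ v ∈ Mh, b (σ - σh) v = 0

lemma WellPosed.isInterpolant_solA (hw : WellPosed j a b ⊤ ⊤) (hwh : WellPosed j a b Sh Mh)
    (g : H) : IsInterpolant b Sh Mh (solA j a b ⊤ ⊤ g) (solA j a b Sh Mh g) :=
  ⟨hwh.solA_mem g, fun v hv => by
    rw [map_sub, sub_apply, hw.b_solA g trivial, hwh.b_solA g hv, sub_self]⟩

namespace IsDiscretization

variable {ρ : ℝ}

lemma mono {ρ' : ℝ} (hd : IsDiscretization j a b Sh Mh ρ) (h : ρ ≤ ρ') :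
    IsDiscretization j a b Sh Mh ρ' where
  finite_S := hd.finite_S
  finite_M := hd.finite_M
  image_subset := hd.image_subset
  subset_image := hd.subset_image
  fortid g σ u hg := by
    obtain ⟨σh, hσh, hb, hle⟩ := hd.fortid g σ u hg
    exact ⟨σh, hσh, hb, hle.trans (by gcongr)⟩
  strong_approx g σ u hg := (hd.strong_approx g σ u hg).trans (by gcongr)

lemma exists_isInterpolant (hd : IsDiscretization j a b Sh Mh ρ) (hw : WellPosed j a b ⊤ ⊤)
    (g : H) : ∃ σ, IsInterpolant b Sh Mh (solA j a b ⊤ ⊤ g) σ ∧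
      normA a (solA j a b ⊤ ⊤ g - σ) ≤ ρ * ‖g‖ := by
  obtain ⟨σ, hσ, hb, hle⟩ := hd.fortid g _ _ (hw.source g)
  exact ⟨σ, ⟨hσ, hb⟩, hle⟩

lemma b_solA (hd : IsDiscretization j a b Sh Mh ρ) (hwh : WellPosed j a b Sh Mh) {w : M}
    (hw : w ∈ Mh) (v : M) : b (solA j a b Sh Mh (j w)) v = -⟪j w, j v⟫ := by
  obtain ⟨w', hw', hb⟩ := hd.image_subset _ (hwh.solA_mem (j w))
  have hsum : j (w' + w) = 0 := by
    have hself := hwh.b_solA (j w) (Mh.add_mem hw' hw)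
    rw [hb, ← add_eq_zero_iff_eq_neg, ← inner_add_left, ← map_add] at hself
    exact inner_self_eq_zero.1 hself
  rw [hb, ← add_eq_zero_iff_eq_neg, ← inner_add_left, ← map_add, hsum, inner_zero_left]

lemma normA_solA_sub_le_of_isInterpolant (hd : IsDiscretization j a b Sh Mh ρ)
    (ha : IsEnergyForm a) (hw : WellPosed j a b ⊤ ⊤) (hwh : WellPosed j a b Sh Mh) {g : H} {σ : S}
    (hσ : IsInterpolant b Sh Mh (solA j a b ⊤ ⊤ g) σ) :
    normA a (solA j a b ⊤ ⊤ g - solA j a b Sh Mh g) ≤ normA a (solA j a b ⊤ ⊤ g - σ) := by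
  have hmem : solA j a b Sh Mh g - σ ∈ Sh := Sh.sub_mem (hwh.solA_mem g) hσ.1
  have hker (v : M) : b (solA j a b Sh Mh g - σ) v = 0 := by
    refine hd.b_eq_zero hmem (fun v hv => ?_) v
    have hsub := (hw.isInterpolant_solA hwh g).2 v hv
    have hsub' := hσ.2 v hv
    simp only [map_sub, sub_apply] at hsub hsub' ⊢
    linarith
  have horth : a (solA j a b ⊤ ⊤ g - solA j a b Sh Mh g) (solA j a b Sh Mh g - σ) = 0 := by
    rw [map_sub a, sub_apply, hw.a_solA_left g trivial, hwh.a_solA_left g hmem, hker, hker,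
      sub_self]
  simpa only [sub_add_sub_cancel] using ha.normA_le_normA_add_of_orthogonal horth

lemma normA_solA_sub_le (hd : IsDiscretization j a b Sh Mh ρ) (ha : IsEnergyForm a)
    (hw : WellPosed j a b ⊤ ⊤) (hwh : WellPosed j a b Sh Mh) (g : H) :
    normA a (solA j a b ⊤ ⊤ g - solA j a b Sh Mh g) ≤ ρ * ‖g‖ := by
  obtain ⟨σ, hσ, hle⟩ := hd.exists_isInterpolant hw g
  exact (hd.normA_solA_sub_le_of_isInterpolant ha hw hwh hσ).trans hle

lemma normA_solA_le (hd : IsDiscretization j a b Sh Mh ρ) (ha : IsEnergyForm a)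
    (hw : WellPosed j a b ⊤ ⊤) (hwh : WellPosed j a b Sh Mh) {K : ℝ}
    (hK : ∀ g : H, normA a (solA j a b ⊤ ⊤ g) ≤ K * ‖g‖) (g : H) :
    normA a (solA j a b Sh Mh g) ≤ (K + ρ) * ‖g‖ := by
  have htri := ha.normA_le_add_sub (solA j a b Sh Mh g) (solA j a b ⊤ ⊤ g)
  rw [normA_sub_comm] at htri
  linarith [hK g, hd.normA_solA_sub_le ha hw hwh g]

lemma inner_solTH_sub_inner_solTH (hd : IsDiscretization j a b Sh Mh ρ) (ha : IsEnergyForm a)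
    (hw : WellPosed j a b ⊤ ⊤) (hwh : WellPosed j a b Sh Mh) {f : H} {w : M} (hwM : w ∈ Mh)
    {σ : S} (hσ : IsInterpolant b Sh Mh (solA j a b ⊤ ⊤ f) σ) :
    ⟪solTH j a b ⊤ ⊤ f, j w⟫ - ⟪f, solTH j a b Sh Mh (j w)⟫ =
      a (solA j a b Sh Mh (j w)) (solA j a b ⊤ ⊤ f - σ) := by
  have hfirst : a (solA j a b Sh Mh (j w)) (solA j a b ⊤ ⊤ f) =
      ⟪solTH j a b ⊤ ⊤ f, j w⟫ := by
    rw [ha.symm, hw.a_solA_left f trivial, hd.b_solA hwh hwM, neg_neg, real_inner_comm]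
    rfl
  have hsecond : a (solA j a b Sh Mh (j w)) σ = ⟪f, solTH j a b Sh Mh (j w)⟫ := by
    have hσb := hσ.2 _ (hwh.solT_mem (j w))
    rw [map_sub, sub_apply, sub_eq_zero, hw.b_solA f trivial] at hσb
    rw [hwh.a_solA_left _ hσ.1, ← hσb, neg_neg]
    rfl
  rw [map_sub, hfirst, hsecond]

lemma exists_residual (hd : IsDiscretization j a b Sh Mh ρ) (hw : WellPosed j a b ⊤ ⊤) {f : H}
    {σ : S} (hσ : IsInterpolant b Sh Mh (solA j a b ⊤ ⊤ f) σ) :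
    ∃ r : H, (∀ v, b (solA j a b ⊤ ⊤ f - σ) v = -⟪r, j v⟫) ∧ (∀ v ∈ Mh, ⟪r, j v⟫ = 0) ∧
      ∀ p ∈ Mh, ‖r‖ ≤ ‖f - j p‖ := by
  obtain ⟨w, hwM, hbw⟩ := hd.image_subset σ hσ.1
  have hres (v : M) : b (solA j a b ⊤ ⊤ f - σ) v = -⟪f + j w, j v⟫ := by
    rw [map_sub, sub_apply, hw.b_solA f trivial, hbw, inner_add_left]
    ring
  have horth (v : M) (hv : v ∈ Mh) : ⟪f + j w, j v⟫ = 0 :=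
    neg_eq_zero.1 ((hres v).symm.trans (hσ.2 v hv))
  refine ⟨f + j w, hres, horth, fun p hp => le_of_sq_le_mul (norm_nonneg _) ?_⟩
  calc ‖f + j w‖ ^ 2 = ⟪f - j p, f + j w⟫ := by
        rw [← real_inner_self_eq_norm_sq, inner_add_left, inner_sub_left,
          real_inner_comm _ (j w), real_inner_comm _ (j p), horth w hwM, horth p hp]
        ring
    _ ≤ ‖f - j p‖ * ‖f + j w‖ := real_inner_le_norm _ _

lemma abs_a_solA_sub_interpolant_le (hd : IsDiscretization j a b Sh Mh ρ)
    (hw : WellPosed j a b ⊤ ⊤) (f g : H) {p q : M} (hp : p ∈ Mh) (hq : q ∈ Mh) {σ : S}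
    (hσ : IsInterpolant b Sh Mh (solA j a b ⊤ ⊤ f) σ) :
    |a (solA j a b ⊤ ⊤ g) (solA j a b ⊤ ⊤ f - σ)| ≤ ‖f - j p‖ * ‖solTH j a b ⊤ ⊤ g - j q‖ := by
  obtain ⟨r, hres, horth, hr⟩ := hd.exists_residual hw hσ
  have heq : a (solA j a b ⊤ ⊤ g) (solA j a b ⊤ ⊤ f - σ) = ⟪r, solTH j a b ⊤ ⊤ g - j q⟫ := by
    rw [hw.a_solA_left g trivial, hres, neg_neg, inner_sub_right, horth q hq, sub_zero]
    rfl
  rw [heq]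
  exact (abs_real_inner_le_norm _ _).trans (by gcongr; exact hr p hp)

end IsDiscretization

section Projection

variable {W Wh : Submodule ℝ M} [FiniteDimensional ℝ Wh]

variable (j Wh) in
/-- The `H`-orthogonal projection onto `Wh`, on elements of `M` and with values in `M`. -/
def projM (x : M) : M :=
  ((inH j Wh).orthogonalProjectionOnto (j x)).2.choose

lemma projM_mem (x : M) : projM j Wh x ∈ Wh :=
  ((inH j Wh).orthogonalProjectionOnto (j x)).2.choose_spec.1

lemma map_projM (x : M) : j (projM j Wh x) = (inH j Wh).orthogonalProjectionOnto (j x) :=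
  ((inH j Wh).orthogonalProjectionOnto (j x)).2.choose_spec.2

lemma inner_projM_left (x : M) {w : M} (hw : w ∈ Wh) : ⟪j (projM j Wh x), j w⟫ = ⟪j x, j w⟫ := by
  rw [map_projM]
  exact (inH j Wh).inner_orthogonalProjectionOnto_eq_of_mem_right ⟨j w, w, hw, rfl⟩ (j x)

lemma norm_sub_sq_eq_add_projM (x : M) {v : M} (hv : v ∈ Wh) :
    ‖j x - j v‖ ^ 2 = ‖j x - j (projM j Wh x)‖ ^ 2 + ‖j (projM j Wh x) - j v‖ ^ 2 := by
  have horth : ⟪j x - j (projM j Wh x), j (projM j Wh x) - j v⟫ = 0 := by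
    rw [← map_sub j (projM j Wh x), inner_sub_left,
      inner_projM_left x (Wh.sub_mem (projM_mem x) hv), sub_self]
  have hpyth := norm_add_sq_real (j x - j (projM j Wh x)) (j (projM j Wh x) - j v)
  rwa [horth, mul_zero, add_zero, sub_add_sub_cancel] at hpyth

lemma norm_sub_projM_le (x : M) {v : M} (hv : v ∈ Wh) :
    ‖j x - j (projM j Wh x)‖ ≤ ‖j x - j v‖ := by
  refine le_of_sq_le_sq ?_ (norm_nonneg _)
  rw [norm_sub_sq_eq_add_projM x hv]
  exact le_add_of_nonneg_right (sq_nonneg _)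

lemma norm_projM_sub_le (x : M) {v : M} (hv : v ∈ Wh) :
    ‖j (projM j Wh x) - j v‖ ≤ ‖j x - j v‖ := by
  refine le_of_sq_le_sq ?_ (norm_nonneg _)
  rw [norm_sub_sq_eq_add_projM x hv]
  exact le_add_of_nonneg_left (sq_nonneg _)

lemma norm_projM_le (x : M) : ‖j (projM j Wh x)‖ ≤ ‖j x‖ := by
  simpa using norm_projM_sub_le (j := j) x Wh.zero_mem

lemma finrank_inH (hj : Function.Injective j) (W : Submodule ℝ M) :
    Module.finrank ℝ (inH j W) = Module.finrank ℝ W :=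
  (Submodule.equivMapOfInjective (j : M →ₗ[ℝ] H) hj W).finrank_eq.symm

lemma norm_le_projF {κ : ℝ} (hκ : ∀ x ∈ W, ‖j x‖ ≤ κ * ‖j (projM j Wh x)‖) (z : inH j W) :
    ‖z‖ ≤ κ * ‖projF (inH j W) (inH j Wh) z‖ := by
  obtain ⟨_, x, hx, rfl⟩ := z
  have hle := hκ x hx
  rwa [map_projM] at hle

lemma bijective_projF [FiniteDimensional ℝ W] (hj : Function.Injective j)
    (hrank : Module.finrank ℝ Wh ≤ Module.finrank ℝ W) {κ : ℝ}
    (hκ : ∀ x ∈ W, ‖j x‖ ≤ κ * ‖j (projM j Wh x)‖) :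
    Function.Bijective (projF (inH j W) (inH j Wh)) := by
  have hinj : Function.Injective (projF (inH j W) (inH j Wh)) := by
    refine (injective_iff_map_eq_zero _).2 fun z hz => ?_
    have hle := norm_le_projF hκ z
    rwa [hz, norm_zero, mul_zero, norm_le_zero_iff] at hle
  refine ⟨hinj, (LinearMap.injective_iff_surjective_of_finrank_eq_finrank ?_).1 hinj⟩
  refine le_antisymm (LinearMap.finrank_le_finrank_of_injective hinj) ?_
  rwa [finrank_inH hj, finrank_inH hj]

lemma exists_projM_eq [FiniteDimensional ℝ W] (hj : Function.Injective j)
    (hrank : Module.finrank ℝ Wh ≤ Module.finrank ℝ W) {κ : ℝ}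
    (hκ : ∀ x ∈ W, ‖j x‖ ≤ κ * ‖j (projM j Wh x)‖) {w : M} (hw : w ∈ Wh) :
    ∃ x ∈ W, projM j Wh x = w := by
  obtain ⟨⟨_, x, hx, rfl⟩, hxw⟩ := (bijective_projF hj hrank hκ).2 ⟨j w, w, hw, rfl⟩
  exact ⟨x, hx, hj ((map_projM x).trans (congrArg Subtype.val hxw))⟩

lemma projF_sub_hatTh (T Th : H →ₗ[ℝ] H) {W Wh : Submodule ℝ H} [FiniteDimensional ℝ Wh]
    (hT : ∀ x ∈ W, T x ∈ W) (hTh : ∀ x ∈ Wh, Th x ∈ Wh)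
    (hF : Function.Bijective (projF W Wh)) (x : W) :
    projF W Wh ((T.restrict hT - hatTh Th W Wh hTh hF) x) =
      projF W Wh (T.restrict hT x) - Th.restrict hTh (projF W Wh x) := by
  rw [LinearMap.sub_apply, map_sub]
  congr 1
  exact LinearEquiv.apply_symm_apply (LinearEquiv.ofBijective _ hF) _

lemma hatEstimate_of_norm_commutator_le [FiniteDimensional ℝ W] (hj : Function.Injective j)
    {T Th : H →ₗ[ℝ] M} (hWT : ∀ x ∈ W, T (j x) ∈ W) (hWhT : ∀ x ∈ Wh, Th (j x) ∈ Wh)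
    (hrank : Module.finrank ℝ Wh ≤ Module.finrank ℝ W) {κ ε : ℝ} (hκ0 : 0 ≤ κ)
    (hκ : ∀ x ∈ W, ‖j x‖ ≤ κ * ‖j (projM j Wh x)‖) (hε : 0 ≤ ε)
    (h : ∀ x ∈ W, ‖j (projM j Wh (T (j x))) - j (Th (j (projM j Wh x)))‖ ≤ ε * ‖j x‖) :
    HatEstimate ((j : M →ₗ[ℝ] H) ∘ₗ T) ((j : M →ₗ[ℝ] H) ∘ₗ Th) (inH j W) (inH j Wh) (κ * ε) := by
  have hT : ∀ x ∈ inH j W, ((j : M →ₗ[ℝ] H) ∘ₗ T) x ∈ inH j W := by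
    rintro _ ⟨x, hx, rfl⟩
    exact ⟨_, hWT x hx, rfl⟩
  have hTh : ∀ x ∈ inH j Wh, ((j : M →ₗ[ℝ] H) ∘ₗ Th) x ∈ inH j Wh := by
    rintro _ ⟨x, hx, rfl⟩
    exact ⟨_, hWhT x hx, rfl⟩
  have hF := bijective_projF hj hrank hκ
  refine ⟨hT, hTh, hF, ContinuousLinearMap.opNorm_le_bound _ (by positivity) fun z => ?_⟩
  obtain ⟨_, x, hx, rfl⟩ := z
  refine (norm_le_projF hκ _).trans ?_
  rw [mul_assoc]
  refine mul_le_mul_of_nonneg_left ?_ hκ0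
  change ‖projF _ _ ((((j : M →ₗ[ℝ] H) ∘ₗ T).restrict hT - hatTh _ _ _ hTh hF) _)‖ ≤ _
  rw [projF_sub_hatTh]
  have hle := h x hx
  rw [map_projM (T (j x)), map_projM x] at hle
  exact hle

end Projection

section Cluster

variable {I : Type*} {u : I → M} {J : Set I}

lemma mem_clusterSpace (u : I → M) {i : I} (hi : i ∈ J) : u i ∈ clusterSpace u J :=
  Submodule.subset_span ⟨i, hi, rfl⟩

lemma clusterSpace_le {W : Submodule ℝ M} (h : ∀ i ∈ J, u i ∈ W) : clusterSpace u J ≤ W :=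
  Submodule.span_le.2 (by rintro _ ⟨i, hi, rfl⟩; exact h i hi)

lemma norm_sum_smul_sq (ho : Orthonormal ℝ fun i => j (u i)) (s : Finset I) (c : I → ℝ) :
    ‖j (∑ i ∈ s, c i • u i)‖ ^ 2 = ∑ i ∈ s, c i ^ 2 := by
  rw [← real_inner_self_eq_norm_sq, map_sum]
  simp only [map_smul]
  rw [ho.inner_sum]
  simp [pow_two]

lemma exists_sum_eq_of_mem_clusterSpace {w : M} (hw : w ∈ clusterSpace u J) :
    ∃ (s : Finset I) (c : I → ℝ), ↑s ⊆ J ∧ ∑ i ∈ s, c i • u i = w := by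
  obtain ⟨l, hl, rfl⟩ := (Finsupp.mem_span_image_iff_linearCombination ℝ).1 hw
  exact ⟨l.support, l, hl, rfl⟩

lemma finrank_clusterSpace [Finite J] (ho : Orthonormal ℝ fun i => j (u i)) :
    Module.finrank ℝ (clusterSpace u J) = J.ncard := by
  have hli : LinearIndependent ℝ u :=
    LinearIndependent.of_comp (j : M →ₗ[ℝ] H) ho.linearIndependent
  have := Fintype.ofFinite J
  rw [clusterSpace, Set.image_eq_range,
    finrank_span_eq_card (b := fun x : J => u x)
      (hli.comp (Subtype.val : J → I) Subtype.val_injective),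
    Set.ncard_eq_toFinset_card', Set.toFinset_card]

end Cluster

variable (j a b Sh Mh) in
/-- `W` is invariant under the solution operator and contained in its range, so that `G` is linear
on `W`; spans of eigenfunctions are of this kind. -/
structure IsSolInvariant (W : Submodule ℝ M) : Prop where
  solT_mem : ∀ w ∈ W, solT j a b Sh Mh (j w) ∈ W
  le_range : W ≤ LinearMap.range (solT j a b Sh Mh)

namespace IsEigensystem

variable {I : Type*} [Preorder I] {lam : I → ℝ} {sig : I → S} {u : I → M} {J : Set I}

lemma solT_apply (he : IsEigensystem j a b Sh Mh lam sig u) (hw : WellPosed j a b Sh Mh) (i : I) :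
    solT j a b Sh Mh (j (u i)) = (lam i)⁻¹ • u i := by
  obtain ⟨hσ, hu, hτ, hv⟩ := he.eigen i
  have hsol : IsSourceSolution j a b Sh Mh (lam i • j (u i)) (sig i) (u i) :=
    ⟨hσ, hu, hτ, fun v hmem => by rw [hv v hmem, real_inner_smul_left, neg_mul]⟩
  rw [eq_inv_smul_iff₀ (he.pos i).ne', ← map_smul]
  exact ((hw _ _ _).1 hsol).2.symm

lemma isSolInvariant_clusterSpace (he : IsEigensystem j a b Sh Mh lam sig u)
    (hw : WellPosed j a b Sh Mh) (J : Set I) : IsSolInvariant j a b Sh Mh (clusterSpace u J) where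
  solT_mem := by
    refine clusterSpace_le
      (W := (clusterSpace u J).comap (solT j a b Sh Mh ∘ₗ (j : M →ₗ[ℝ] H))) fun i hi => ?_
    change solT j a b Sh Mh (j (u i)) ∈ clusterSpace u J
    rw [he.solT_apply hw]
    exact Submodule.smul_mem _ _ (mem_clusterSpace u hi)
  le_range := clusterSpace_le fun i _ => ⟨lam i • j (u i), by
    rw [map_smul, he.solT_apply hw, smul_inv_smul₀ (he.pos i).ne']⟩

lemma a_sig (he : IsEigensystem j a b Sh Mh lam sig u) {i : I} {w : M} {σ : S}
    (hw : w ∈ Mh) (h : ∀ τ ∈ Sh, a σ τ + b τ w = 0) :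
    a σ (sig i) = lam i * ⟪j (u i), j w⟫ := by
  obtain ⟨hσ, -, -, hv⟩ := he.eigen i
  have hτ := h _ hσ
  rw [hv _ hw] at hτ
  linarith

lemma exists_solT_eq (he : IsEigensystem j a b Sh Mh lam sig u) (hw : WellPosed j a b Sh Mh)
    {L : ℝ} (hL : ∀ i ∈ J, lam i ≤ L) (hL0 : 0 ≤ L) {w : M} (h : w ∈ clusterSpace u J) :
    ∃ v ∈ clusterSpace u J, solT j a b Sh Mh (j v) = w ∧ ‖j v‖ ≤ L * ‖j w‖ := by
  obtain ⟨s, c, hs, rfl⟩ := exists_sum_eq_of_mem_clusterSpace h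
  refine ⟨∑ i ∈ s, (lam i * c i) • u i, Submodule.sum_mem _ fun i hi =>
    Submodule.smul_mem _ _ (mem_clusterSpace u (hs hi)), ?_, le_of_sq_le_sq ?_ (by positivity)⟩
  · simp only [map_sum, map_smul]
    refine Finset.sum_congr rfl fun i _ => ?_
    rw [he.solT_apply hw, smul_smul, mul_right_comm, mul_inv_cancel₀ (he.pos i).ne', one_mul]
  · rw [norm_sum_smul_sq he.orthonormal, mul_pow, norm_sum_smul_sq he.orthonormal, Finset.mul_sum]
    refine Finset.sum_le_sum fun i hi => ?_
    have hpos := (he.pos i).le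
    rw [mul_pow]
    gcongr
    exact hL i (hs hi)

lemma normA_G_le (he : IsEigensystem j a b Sh Mh lam sig u) (hw : WellPosed j a b Sh Mh)
    (ha : IsEnergyForm a) {L : ℝ} (hL : ∀ i ∈ J, lam i ≤ L ^ 2) (hL0 : 0 ≤ L) {w : M}
    (h : w ∈ clusterSpace u J) : normA a (G a b Sh w) ≤ L * ‖j w‖ := by
  obtain ⟨v, -, rfl, hle⟩ := he.exists_solT_eq hw hL (by positivity) h
  refine le_of_sq_le_sq ?_ (by positivity)
  calc normA a (G a b Sh (solT j a b Sh Mh (j v))) ^ 2 = ⟪j v, j (solT j a b Sh Mh (j v))⟫ := by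
        rw [hw.G_solT ha, ha.normA_sq, hw.a_solA]; rfl
    _ ≤ (L ^ 2 * ‖j (solT j a b Sh Mh (j v))‖) * ‖j (solT j a b Sh Mh (j v))‖ :=
        (real_inner_le_norm _ _).trans (by gcongr)
    _ = (L * ‖j (solT j a b Sh Mh (j v))‖) ^ 2 := by ring

end IsEigensystem

section Gap

lemma mixedDist_nonneg (x v : M) : 0 ≤ mixedDist j a b Sh x v := Real.sqrt_nonneg _

lemma norm_sub_le_mixedDist (x v : M) : ‖j x - j v‖ ≤ mixedDist j a b Sh x v :=
  Real.le_sqrt_of_sq_le (le_add_of_nonneg_right (sq_nonneg _))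

lemma normA_sub_le_mixedDist (x v : M) :
    normA a (G a b ⊤ x - G a b Sh v) ≤ mixedDist j a b Sh x v :=
  Real.le_sqrt_of_sq_le (le_add_of_nonneg_left (sq_nonneg _))

lemma mixedDist_le_add (x v : M) :
    mixedDist j a b Sh x v ≤ ‖j x - j v‖ + normA a (G a b ⊤ x - G a b Sh v) := by
  have hnorm := norm_nonneg (j x - j v)
  have hnormA := normA_nonneg (a := a) (G a b ⊤ x - G a b Sh v)
  exact Real.sqrt_le_iff.2 ⟨by positivity, by nlinarith [mul_nonneg hnorm hnormA]⟩

lemma iInf_mixedDist_le {Wh : Submodule ℝ M} (x : M) {v : M} (hv : v ∈ Wh) :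
    ⨅ v : Wh, mixedDist j a b Sh x (v : M) ≤ mixedDist j a b Sh x v :=
  ciInf_le ⟨0, by rintro _ ⟨w, rfl⟩; exact mixedDist_nonneg _ _⟩ (⟨v, hv⟩ : Wh)

lemma gap_nonneg (W Wh : Submodule ℝ M) : 0 ≤ gap j a b Sh W Wh :=
  Real.iSup_nonneg fun _ => Real.iInf_nonneg fun _ => mixedDist_nonneg _ _

lemma gap_le {W Wh : Submodule ℝ M} {ε : ℝ} (hε : 0 ≤ ε)
    (h : ∀ x ∈ W, ‖j x‖ = 1 → ∃ v ∈ Wh, mixedDist j a b Sh x v ≤ ε) :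
    gap j a b Sh W Wh ≤ ε := by
  refine Real.iSup_le (fun x => ?_) hε
  obtain ⟨v, hv, hle⟩ := h x x.2.1 x.2.2
  exact (iInf_mixedDist_le _ hv).trans hle

lemma mixedDist_smul (ha : IsEnergyForm a) (hw : WellPosed j a b ⊤ ⊤)
    (hwh : WellPosed j a b Sh Mh) (c : ℝ) {x v : M}
    (hx : x ∈ LinearMap.range (solT j a b ⊤ ⊤)) (hv : v ∈ LinearMap.range (solT j a b Sh Mh)) :
    mixedDist j a b Sh (c • x) (c • v) = |c| * mixedDist j a b Sh x v := by
  unfold mixedDist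
  rw [hw.G_smul ha _ hx, hwh.G_smul ha _ hv, ← smul_sub, map_smul, map_smul, ← smul_sub,
    normA_smul, norm_smul, Real.norm_eq_abs, mul_pow, mul_pow, ← mul_add,
    Real.sqrt_mul (sq_nonneg _), Real.sqrt_sq (abs_nonneg c)]

variable {W Wh : Submodule ℝ M}

lemma iInf_mixedDist_smul_le (ha : IsEnergyForm a) (hw : WellPosed j a b ⊤ ⊤)
    (hwh : WellPosed j a b Sh Mh) (hWh : Wh ≤ LinearMap.range (solT j a b Sh Mh)) (c : ℝ) {x : M}
    (hx : x ∈ LinearMap.range (solT j a b ⊤ ⊤)) :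
    ⨅ v : Wh, mixedDist j a b Sh (c • x) (v : M) ≤
      |c| * ⨅ v : Wh, mixedDist j a b Sh x (v : M) := by
  rw [Real.mul_iInf_of_nonneg (abs_nonneg c)]
  refine le_ciInf fun v => ?_
  rw [← mixedDist_smul ha hw hwh c hx (hWh v.2)]
  exact iInf_mixedDist_le _ (Wh.smul_mem c v.2)

lemma bddAbove_iInf_mixedDist (ha : IsEnergyForm a) {L : ℝ}
    (hL : ∀ x ∈ W, normA a (G a b ⊤ x) ≤ L * ‖j x‖) :
    BddAbove (Set.range fun x : {x : M // x ∈ W ∧ ‖j x‖ = 1} =>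
      ⨅ v : Wh, mixedDist j a b Sh (x : M) (v : M)) := by
  have hG0 : G a b Sh (0 : M) = 0 := ha.G_eq Sh.zero_mem (by simp)
  refine ⟨1 + L, ?_⟩
  rintro _ ⟨⟨x, hx, hx1⟩, rfl⟩
  refine (iInf_mixedDist_le x Wh.zero_mem).trans ((mixedDist_le_add x 0).trans ?_)
  have hle := hL x hx
  rw [hx1, mul_one] at hle
  rw [map_zero, sub_zero, hG0, sub_zero, hx1]
  gcongr

lemma iInf_mixedDist_le_gap_mul (ha : IsEnergyForm a) (hj : Function.Injective j)
    (hw : WellPosed j a b ⊤ ⊤) (hwh : WellPosed j a b Sh Mh)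
    (hW : W ≤ LinearMap.range (solT j a b ⊤ ⊤)) (hWh : Wh ≤ LinearMap.range (solT j a b Sh Mh))
    {L : ℝ} (hL : ∀ x ∈ W, normA a (G a b ⊤ x) ≤ L * ‖j x‖) {x : M} (hx : x ∈ W) :
    ⨅ v : Wh, mixedDist j a b Sh x (v : M) ≤ gap j a b Sh W Wh * ‖j x‖ := by
  rcases eq_or_ne x 0 with rfl | hx0
  · simpa using iInf_mixedDist_smul_le ha hw hwh hWh 0 (hW hx)
  have hpos : 0 < ‖j x‖ := norm_pos_iff.2 ((map_ne_zero_iff j hj).2 hx0)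
  let y : {y : M // y ∈ W ∧ ‖j y‖ = 1} :=
    ⟨‖j x‖⁻¹ • x, W.smul_mem _ hx, by
      rw [map_smul, norm_smul, norm_inv, norm_norm, inv_mul_cancel₀ hpos.ne']⟩
  have hscale := iInf_mixedDist_smul_le ha hw hwh hWh ‖j x‖ (hW y.2.1)
  rw [smul_inv_smul₀ hpos.ne', abs_norm, mul_comm] at hscale
  refine hscale.trans (mul_le_mul_of_nonneg_right ?_ hpos.le)
  exact le_ciSup (bddAbove_iInf_mixedDist (j := j) (Sh := Sh) (Wh := Wh) ha hL) y

lemma norm_sub_projM_le_iInf_mixedDist [FiniteDimensional ℝ Wh] (x : M) :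
    ‖j x - j (projM j Wh x)‖ ≤ ⨅ v : Wh, mixedDist j a b Sh x (v : M) :=
  le_ciInf fun v => (norm_sub_projM_le x v.2).trans (norm_sub_le_mixedDist _ _)

lemma normA_G_sub_projM_le_iInf_mixedDist [FiniteDimensional ℝ Wh] (ha : IsEnergyForm a)
    (hwh : WellPosed j a b Sh Mh) (hWh : Wh ≤ LinearMap.range (solT j a b Sh Mh)) {L : ℝ}
    (hL0 : 0 ≤ L) (hL : ∀ w ∈ Wh, normA a (G a b Sh w) ≤ L * ‖j w‖) (x : M) :
    normA a (G a b ⊤ x - G a b Sh (projM j Wh x)) ≤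
      (1 + L) * ⨅ v : Wh, mixedDist j a b Sh x (v : M) := by
  rw [Real.mul_iInf_of_nonneg (by positivity)]
  refine le_ciInf fun ⟨v, hv⟩ => ?_
  have hproj : normA a (G a b Sh v - G a b Sh (projM j Wh x)) ≤ L * mixedDist j a b Sh x v := by
    rw [normA_sub_comm, ← hwh.G_sub ha (hWh (projM_mem x)) (hWh hv)]
    refine (hL _ (Wh.sub_mem (projM_mem x) hv)).trans ?_
    rw [map_sub]
    gcongr
    exact (norm_projM_sub_le x hv).trans (norm_sub_le_mixedDist _ _)
  have htri := ha.normA_sub_le (G a b ⊤ x) (G a b Sh v) (G a b Sh (projM j Wh x))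
  linarith [normA_sub_le_mixedDist (j := j) (a := a) (b := b) (Sh := Sh) x v]

end Gap

lemma norm_le_inv_mul_norm_projM {W Wh : Submodule ℝ M} [FiniteDimensional ℝ Wh] {θ : ℝ}
    (hθ : θ < 1) (h : ∀ x ∈ W, ‖j x - j (projM j Wh x)‖ ≤ θ * ‖j x‖) :
    ∀ x ∈ W, ‖j x‖ ≤ (1 - θ)⁻¹ * ‖j (projM j Wh x)‖ := by
  intro x hx
  rw [le_inv_mul_iff₀ (sub_pos.2 hθ)]
  linarith [h x hx, norm_sub_norm_le (j x) (j (projM j Wh x))]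

section Quadratic

/-- `Wh` approximates `W`: `δ` and `η` bound the errors of the projection onto `Wh` in the norm of
`H` and, after application of `G` and `G_h`, in the energy norm, and `κ` bounds a right inverse of
`F_h : W → Wh`. -/
structure IsClusterApprox (j : M →L[ℝ] H) (a : S →L[ℝ] S →L[ℝ] ℝ) (b : S →L[ℝ] M →L[ℝ] ℝ)
    (Sh : Submodule ℝ S) (W Wh : Submodule ℝ M) [FiniteDimensional ℝ Wh] (δ η κ : ℝ) : Prop where
  delta_nonneg : 0 ≤ δ
  eta_nonneg : 0 ≤ η
  kappa_nonneg : 0 ≤ κ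
  norm_sub_le : ∀ x ∈ W, ‖j x - j (projM j Wh x)‖ ≤ δ * ‖j x‖
  normA_G_sub_le : ∀ x ∈ W, normA a (G a b ⊤ x - G a b Sh (projM j Wh x)) ≤ η * ‖j x‖
  exists_lift : ∀ w ∈ Wh, ∃ x ∈ W, projM j Wh x = w ∧ ‖j x‖ ≤ κ * ‖j w‖

variable {W Wh : Submodule ℝ M} [FiniteDimensional ℝ Wh] {ρ K Kh Lh δ η κ : ℝ}

lemma norm_commutator_sq (ha : IsEnergyForm a) (hw : WellPosed j a b ⊤ ⊤)
    (hwh : WellPosed j a b Sh Mh) (hd : IsDiscretization j a b Sh Mh ρ)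
    (hWh : IsSolInvariant j a b Sh Mh Wh) (x : M) {σ : S}
    (hσ : IsInterpolant b Sh Mh (solA j a b ⊤ ⊤ (j x)) σ) {w : M}
    (hwdef : w = projM j Wh (solT j a b ⊤ ⊤ (j x)) - solT j a b Sh Mh (j (projM j Wh x))) :
    ‖j w‖ ^ 2 = a (solA j a b Sh Mh (j w)) (solA j a b ⊤ ⊤ (j x) - σ) := by
  have hwW : w ∈ Wh := hwdef ▸ Wh.sub_mem (projM_mem _) (hWh.solT_mem _ (projM_mem _))
  have hT : ⟪j (projM j Wh (solT j a b ⊤ ⊤ (j x))), j w⟫ = ⟪solTH j a b ⊤ ⊤ (j x), j w⟫ :=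
    inner_projM_left _ hwW
  have hTh : ⟪j (solT j a b Sh Mh (j (projM j Wh x))), j w⟫ = ⟪j x, solTH j a b Sh Mh (j w)⟫ :=
    (hwh.isSymmetric_solTH ha _ _).trans (inner_projM_left x (hWh.solT_mem _ hwW))
  rw [← hd.inner_solTH_sub_inner_solTH ha hw hwh (hwh.range_solT_le (hWh.le_range hwW)) hσ, ← hT,
    ← hTh, ← inner_sub_left, ← map_sub, ← hwdef, real_inner_self_eq_norm_sq]

namespace IsClusterApprox

/- Tested with itself, the commutator equals the error of the interpolant paired with the flux of a
discrete function; replacing that flux by the one of a lift to `W` makes both factors small. -/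
lemma norm_commutator_le (hc : IsClusterApprox j a b Sh W Wh δ η κ) (ha : IsEnergyForm a)
    (hw : WellPosed j a b ⊤ ⊤) (hwh : WellPosed j a b Sh Mh)
    (hd : IsDiscretization j a b Sh Mh ρ) (hW : IsSolInvariant j a b ⊤ ⊤ W)
    (hWh : IsSolInvariant j a b Sh Mh Wh)
    (hKh : ∀ g : H, normA a (solA j a b Sh Mh g) ≤ Kh * ‖g‖) {x : M} (hx : x ∈ W) {σ : S}
    (hσ : IsInterpolant b Sh Mh (solA j a b ⊤ ⊤ (j x)) σ) {e : ℝ} (he : 0 ≤ e)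
    (hle : normA a (solA j a b ⊤ ⊤ (j x) - σ) ≤ e * ‖j x‖) :
    ‖j (projM j Wh (solT j a b ⊤ ⊤ (j x))) - j (solT j a b Sh Mh (j (projM j Wh x)))‖ ≤
      κ * Kh ^ 2 * (η * e + δ ^ 2) * ‖j x‖ := by
  obtain ⟨hδ, hη, hκ, hδW, hηW, hlift⟩ := hc
  rw [← map_sub]
  set w := projM j Wh (solT j a b ⊤ ⊤ (j x)) - solT j a b Sh Mh (j (projM j Wh x)) with hwdef
  have hwW : w ∈ Wh := Wh.sub_mem (projM_mem _) (hWh.solT_mem _ (projM_mem _))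
  obtain ⟨y, hy, hyw, hyle⟩ := hlift _ (hWh.solT_mem _ hwW)
  have hprojMh (z : M) : projM j Wh z ∈ Mh := hwh.range_solT_le (hWh.le_range (projM_mem z))
  set ε := solA j a b ⊤ ⊤ (j x) - σ
  have hsmooth : |a (G a b ⊤ y) ε| ≤ (δ * ‖j x‖) * (δ * ‖j y‖) := by
    obtain ⟨g, hg⟩ := hW.le_range hy
    have hdual := hd.abs_a_solA_sub_interpolant_le hw (j x) g (hprojMh x) (hprojMh y) hσ
    rw [← hw.G_solT ha, hg, solTH, LinearMap.comp_apply, hg] at hdual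
    refine hdual.trans ?_
    gcongr
    exacts [hδW x hx, hδW y hy]
  have hrough : |a (G a b ⊤ y - G a b Sh (projM j Wh y)) ε| ≤ (η * ‖j y‖) * (e * ‖j x‖) := by
    refine (ha.abs_apply_le _ _).trans ?_
    gcongr
    exacts [normA_nonneg _, hηW y hy]
  have hsplit : ‖j w‖ ^ 2 =
      a (G a b ⊤ y) ε - a (G a b ⊤ y - G a b Sh (projM j Wh y)) ε := by
    rw [norm_commutator_sq ha hw hwh hd hWh x hσ hwdef, map_sub a, sub_apply, hyw, hwh.G_solT ha,
      sub_sub_cancel]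
  have hyle' : ‖j y‖ ≤ κ * (Kh ^ 2 * ‖j w‖) :=
    hyle.trans (by gcongr; exact hwh.norm_solTH_le ha hKh _)
  refine le_of_sq_le_mul (by positivity) ?_
  calc ‖j w‖ ^ 2 ≤ (η * e + δ ^ 2) * ‖j x‖ * ‖j y‖ := by
        rw [hsplit]
        linarith [(abs_le.1 hsmooth).2, (abs_le.1 hrough).1]
    _ ≤ (η * e + δ ^ 2) * ‖j x‖ * (κ * (Kh ^ 2 * ‖j w‖)) := by gcongr
    _ = κ * Kh ^ 2 * (η * e + δ ^ 2) * ‖j x‖ * ‖j w‖ := by ring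

lemma normA_solA_sub_le (hc : IsClusterApprox j a b Sh W Wh δ η κ) (ha : IsEnergyForm a)
    (hw : WellPosed j a b ⊤ ⊤) (hwh : WellPosed j a b Sh Mh) (hW : IsSolInvariant j a b ⊤ ⊤ W)
    (hWh : IsSolInvariant j a b Sh Mh Wh)
    (hK : ∀ g : H, normA a (solA j a b ⊤ ⊤ g) ≤ K * ‖g‖) (hKh0 : 0 ≤ Kh)
    (hKh : ∀ g : H, normA a (solA j a b Sh Mh g) ≤ Kh * ‖g‖) (hLh0 : 0 ≤ Lh)
    (hLh : ∀ w ∈ Wh, normA a (G a b Sh w) ≤ Lh * ‖j w‖) {x : M} (hx : x ∈ W) {ε : ℝ}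
    (hε : ‖j (projM j Wh (solT j a b ⊤ ⊤ (j x))) - j (solT j a b Sh Mh (j (projM j Wh x)))‖ ≤
      ε * ‖j x‖) :
    normA a (solA j a b ⊤ ⊤ (j x) - solA j a b Sh Mh (j x)) ≤
      (η * K ^ 2 + Lh * ε + Kh * δ) * ‖j x‖ := by
  set y := solT j a b ⊤ ⊤ (j x)
  have hproj : normA a (solA j a b ⊤ ⊤ (j x) - G a b Sh (projM j Wh y)) ≤ η * (K ^ 2 * ‖j x‖) := by
    rw [← hw.G_solT ha]
    refine (hc.normA_G_sub_le _ (hW.solT_mem x hx)).trans ?_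
    have := hc.eta_nonneg
    gcongr
    exact hw.norm_solTH_le ha hK _
  have hcomm : normA a (G a b Sh (projM j Wh y) - solA j a b Sh Mh (j (projM j Wh x))) ≤
      Lh * (ε * ‖j x‖) := by
    rw [← hwh.G_solT ha, ← hwh.G_sub ha (hWh.le_range (projM_mem _)) ⟨_, rfl⟩]
    refine (hLh _ (Wh.sub_mem (projM_mem _) (hWh.solT_mem _ (projM_mem _)))).trans ?_
    rw [map_sub]
    gcongr
  have hdata : normA a (solA j a b Sh Mh (j (projM j Wh x)) - solA j a b Sh Mh (j x)) ≤
      Kh * (δ * ‖j x‖) := by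
    rw [normA_sub_comm, ← map_sub]
    exact (hKh _).trans (by gcongr; exact hc.norm_sub_le x hx)
  have htri := ha.normA_sub_le (solA j a b ⊤ ⊤ (j x)) (G a b Sh (projM j Wh y))
    (solA j a b Sh Mh (j x))
  have htri' := ha.normA_sub_le (G a b Sh (projM j Wh y)) (solA j a b Sh Mh (j (projM j Wh x)))
    (solA j a b Sh Mh (j x))
  linarith

/- The Fortin interpolant gives a commutator of order `δ`, hence a discrete flux `A_h x` with error
of order `δ`; using `A_h x` as interpolant then gives a commutator of order `δ ^ 2`. -/
theorem norm_commutator_le_sq {D : ℝ} (hc : IsClusterApprox j a b Sh W Wh δ (D * δ) κ)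
    (hδ1 : δ ≤ 1) (hD : 0 ≤ D) (ha : IsEnergyForm a) (hw : WellPosed j a b ⊤ ⊤)
    (hwh : WellPosed j a b Sh Mh) (hρ : 0 ≤ ρ) (hd : IsDiscretization j a b Sh Mh ρ)
    (hW : IsSolInvariant j a b ⊤ ⊤ W) (hWh : IsSolInvariant j a b Sh Mh Wh)
    (hK : ∀ g : H, normA a (solA j a b ⊤ ⊤ g) ≤ K * ‖g‖) (hKh0 : 0 ≤ Kh)
    (hKh : ∀ g : H, normA a (solA j a b Sh Mh g) ≤ Kh * ‖g‖) (hLh0 : 0 ≤ Lh)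
    (hLh : ∀ w ∈ Wh, normA a (G a b Sh w) ≤ Lh * ‖j w‖) {x : M} (hx : x ∈ W) :
    ‖j (projM j Wh (solT j a b ⊤ ⊤ (j x))) - j (solT j a b Sh Mh (j (projM j Wh x)))‖ ≤
      κ * Kh ^ 2 * (D * (D * K ^ 2 + Lh * (κ * Kh ^ 2 * (D * ρ + 1)) + Kh) + 1) * δ ^ 2 *
        ‖j x‖ := by
  have hδ := hc.delta_nonneg
  have hκ := hc.kappa_nonneg
  obtain ⟨σ, hσ, hle⟩ := hd.exists_isInterpolant hw (j x)
  have hlinear := calc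
    ‖j (projM j Wh (solT j a b ⊤ ⊤ (j x))) - j (solT j a b Sh Mh (j (projM j Wh x)))‖
      ≤ κ * Kh ^ 2 * (D * δ * ρ + δ ^ 2) * ‖j x‖ :=
        hc.norm_commutator_le ha hw hwh hd hW hWh hKh hx hσ hρ hle
    _ ≤ κ * Kh ^ 2 * (D * δ * ρ + δ) * ‖j x‖ := by
        gcongr
        exact pow_le_of_le_one hδ hδ1 two_ne_zero
    _ = (κ * Kh ^ 2 * (D * ρ + 1) * δ) * ‖j x‖ := by ring
  have henergy := hc.normA_solA_sub_le ha hw hwh hW hWh hK hKh0 hKh hLh0 hLh hx hlinear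
  refine (hc.norm_commutator_le ha hw hwh hd hW hWh hKh hx (hw.isInterpolant_solA hwh (j x))
    (by positivity) henergy).trans (le_of_eq (by ring))

end IsClusterApprox

end Quadratic

section HatEstimate

variable {W Wh : Submodule ℝ M} [FiniteDimensional ℝ W] [FiniteDimensional ℝ Wh]

lemma isClusterApprox_of_gap_le (ha : IsEnergyForm a) (hj : Function.Injective j)
    (hw : WellPosed j a b ⊤ ⊤) (hwh : WellPosed j a b Sh Mh)
    (hW : W ≤ LinearMap.range (solT j a b ⊤ ⊤)) (hWh : Wh ≤ LinearMap.range (solT j a b Sh Mh))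
    {L Lh θ : ℝ} (hL : ∀ x ∈ W, normA a (G a b ⊤ x) ≤ L * ‖j x‖) (hLh0 : 0 ≤ Lh)
    (hLh : ∀ w ∈ Wh, normA a (G a b Sh w) ≤ Lh * ‖j w‖)
    (hrank : Module.finrank ℝ Wh ≤ Module.finrank ℝ W) (hθ : θ < 1)
    (hgap : gap j a b Sh W Wh ≤ θ) :
    IsClusterApprox j a b Sh W Wh (gap j a b Sh W Wh) ((1 + Lh) * gap j a b Sh W Wh)
      (1 - θ)⁻¹ := by
  have hinf (x : M) (hx : x ∈ W) := iInf_mixedDist_le_gap_mul ha hj hw hwh hW hWh hL hx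
  have hdist (x : M) (hx : x ∈ W) := (norm_sub_projM_le_iInf_mixedDist x).trans (hinf x hx)
  have hκ := norm_le_inv_mul_norm_projM hθ fun x hx => (hdist x hx).trans (by gcongr)
  have hδ := gap_nonneg (j := j) (a := a) (b := b) (Sh := Sh) W Wh
  refine ⟨hδ, by positivity, inv_nonneg.2 (sub_pos.2 hθ).le, hdist, fun x hx => ?_, fun w hw => ?_⟩
  · refine (normA_G_sub_projM_le_iInf_mixedDist ha hwh hWh hLh0 hLh x).trans ?_
    rw [mul_assoc]
    gcongr
    exact hinf x hx
  · obtain ⟨x, hx, rfl⟩ := exists_projM_eq hj hrank hκ hw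
    exact ⟨x, hx, rfl, hκ x hx⟩

theorem exists_hatEstimate_of_gap_le (ha : IsEnergyForm a) (hj : Function.Injective j)
    (hw : WellPosed j a b ⊤ ⊤) {K : ℝ} (hK0 : 0 ≤ K)
    (hK : ∀ g : H, normA a (solA j a b ⊤ ⊤ g) ≤ K * ‖g‖) (hW : IsSolInvariant j a b ⊤ ⊤ W) {L : ℝ}
    (hL : ∀ x ∈ W, normA a (G a b ⊤ x) ≤ L * ‖j x‖) {ρ Lh θ : ℝ} (hρ : 0 ≤ ρ) (hLh0 : 0 ≤ Lh)
    (hθ : θ < 1) :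
    ∃ C : ℝ, ∀ (Sh : Submodule ℝ S) (Mh Wh : Submodule ℝ M) [FiniteDimensional ℝ Wh],
      IsDiscretization j a b Sh Mh ρ → IsSolInvariant j a b Sh Mh Wh →
      (∀ w ∈ Wh, normA a (G a b Sh w) ≤ Lh * ‖j w‖) →
      Module.finrank ℝ Wh ≤ Module.finrank ℝ W → gap j a b Sh W Wh ≤ θ →
      HatEstimate (solTH j a b ⊤ ⊤) (solTH j a b Sh Mh) (inH j W) (inH j Wh)
        (C * gap j a b Sh W Wh ^ 2) := by
  refine ⟨(1 - θ)⁻¹ * ((1 - θ)⁻¹ * (K + ρ) ^ 2 * ((1 + Lh) * ((1 + Lh) * K ^ 2 +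
    Lh * ((1 - θ)⁻¹ * (K + ρ) ^ 2 * ((1 + Lh) * ρ + 1)) + (K + ρ)) + 1)), ?_⟩
  intro Sh Mh Wh _ hd hWh hLh hrank hgap
  have hwh := hd.wellPosed ha hj
  have hKh := hd.normA_solA_le ha hw hwh hK
  have hc := isClusterApprox_of_gap_le ha hj hw hwh hW.le_range hWh.le_range hL hLh0 hLh hrank hθ
    hgap
  have hκ0 := hc.kappa_nonneg
  have hκ := norm_le_inv_mul_norm_projM hθ fun x hx => (hc.norm_sub_le x hx).trans (by gcongr)
  have hcomm (x : M) (hx : x ∈ W) := hc.norm_commutator_le_sq (hgap.trans hθ.le) (by positivity) ha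
    hw hwh hρ hd hW hWh hK (by positivity) hKh hLh0 hLh hx
  rw [mul_assoc]
  exact hatEstimate_of_norm_commutator_le hj hW.solT_mem hWh.solT_mem hrank hκ0 hκ
    (by positivity) hcomm

end HatEstimate

namespace IsEigensystem

lemma exists_lam_le_sq {I : Type*} [Preorder I] {lam : I → ℝ} {sig : I → S} {u : I → M}
    (he : IsEigensystem j a b Sh Mh lam sig u) (J : Set I) [Finite J] :
    ∃ L : ℝ, 0 ≤ L ∧ ∀ i ∈ J, lam i ≤ L ^ 2 := by
  obtain ⟨B, hB⟩ := (J.toFinite.image lam).bddAbove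
  refine ⟨Real.sqrt B, Real.sqrt_nonneg _, fun i hi => ?_⟩
  have hle := hB (Set.mem_image_of_mem lam hi)
  rwa [Real.sq_sqrt ((he.pos i).le.trans hle)]

section

variable {I : Type*} [Preorder I] {lam : I → ℝ} {sig : I → S} {u : I → M}

lemma normA_sig (he : IsEigensystem j a b Sh Mh lam sig u) (i : I) :
    normA a (sig i) = Real.sqrt (lam i) := by
  obtain ⟨-, hu, hτ, -⟩ := he.eigen i
  rw [normA, he.a_sig hu hτ, real_inner_self_eq_norm_sq, he.orthonormal.norm_eq_one, one_pow,
    mul_one]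

lemma sqrt_lam_mul_inner_le (he : IsEigensystem j a b Sh Mh lam sig u) (hw : WellPosed j a b Sh Mh)
    (ha : IsEnergyForm a) (i : I) {v : M} (hv : v ∈ LinearMap.range (solT j a b Sh Mh)) :
    Real.sqrt (lam i) * ⟪j (u i), j v⟫ ≤ normA a (G a b Sh v) := by
  obtain ⟨g, rfl⟩ := hv
  have hle := ha.apply_le (solA j a b Sh Mh g) (sig i)
  rw [he.a_sig (hw.solT_mem g) (hw.source g).2.2.1, he.normA_sig] at hle
  rw [hw.G_solT ha]
  refine le_of_mul_le_mul_right ?_ (Real.sqrt_pos.2 (he.pos i))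
  rwa [mul_right_comm, Real.mul_self_sqrt (he.pos i).le]

/- Every `v` in the cluster is tested against `u k`: there `(u k, v) = (x, v)` is close to
`‖x‖ ^ 2`, while `|G_h v|_a` is close to `|G x|_a ≤ L ‖x‖`. -/
lemma sqrt_lam_le_of_projM_eq (he : IsEigensystem j a b Sh Mh lam sig u)
    (hw : WellPosed j a b Sh Mh) (ha : IsEnergyForm a) {Wh : Submodule ℝ M}
    [FiniteDimensional ℝ Wh] (hWh : Wh ≤ LinearMap.range (solT j a b Sh Mh)) {x : M} {k : I}
    (hx : projM j Wh x = u k) {L θ : ℝ} (hθ : θ < 1) (hL : normA a (G a b ⊤ x) ≤ L * ‖j x‖)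
    (hdist : ⨅ v : Wh, mixedDist j a b Sh x (v : M) ≤ θ * ‖j x‖) :
    Real.sqrt (lam k) ≤ (L + θ) / (1 - θ) := by
  set s := Real.sqrt (lam k)
  have hs0 : 0 ≤ s := Real.sqrt_nonneg _
  have hx1 : 1 ≤ ‖j x‖ := by
    rw [← he.orthonormal.norm_eq_one k, ← hx]
    exact norm_projM_le x
  have hv (v : Wh) : s * ‖j x‖ ^ 2 - L * ‖j x‖ ≤ (1 + s * ‖j x‖) * mixedDist j a b Sh x v := by
    have henergy : normA a (G a b Sh (v : M)) ≤ L * ‖j x‖ + mixedDist j a b Sh x v := by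
      have htri := ha.normA_le_add_sub (G a b Sh (v : M)) (G a b ⊤ x)
      rw [normA_sub_comm] at htri
      linarith [normA_sub_le_mixedDist (j := j) (a := a) (b := b) (Sh := Sh) x v]
    have hinner : ‖j x‖ ^ 2 - ‖j x‖ * mixedDist j a b Sh x v ≤ ⟪j (u k), j (v : M)⟫ := by
      have hcs := (real_inner_le_norm (j x) (j x - j v)).trans
        (mul_le_mul_of_nonneg_left (norm_sub_le_mixedDist (a := a) (b := b) (Sh := Sh) x (v : M))
          (norm_nonneg _))
      rw [inner_sub_right, real_inner_self_eq_norm_sq] at hcs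
      rw [← hx, inner_projM_left x v.2]
      linarith
    have hle := (mul_le_mul_of_nonneg_left hinner hs0).trans
      ((he.sqrt_lam_mul_inner_le hw ha k (hWh v.2)).trans henergy)
    linarith
  have hinf := (le_ciInf hv).trans_eq (Real.mul_iInf_of_nonneg (by positivity) _).symm
  have hle : s * ‖j x‖ ^ 2 - L * ‖j x‖ ≤ (1 + s * ‖j x‖) * (θ * ‖j x‖) :=
    hinf.trans (mul_le_mul_of_nonneg_left hdist (by positivity))
  rw [le_div_iff₀ (sub_pos.2 hθ)]
  have hcancel : s * ‖j x‖ * (1 - θ) ≤ L + θ :=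
    le_of_mul_le_mul_right (by linarith) (one_pos.trans_le hx1)
  exact (mul_le_mul_of_nonneg_right (le_mul_of_one_le_right hs0 hx1)
    (sub_pos.2 hθ).le).trans hcancel

end

variable {lam : ℕ → ℝ} {sig : ℕ → S} {u : ℕ → M}

lemma finrank_clusterSpace_fin_le {m : ℕ} {lamh : Fin m → ℝ} {sigh : Fin m → S}
    {uh : Fin m → M} (he : IsEigensystem j a b ⊤ ⊤ lam sig u)
    (heh : IsEigensystem j a b Sh Mh lamh sigh uh) (J : Set ℕ) [Finite J] :
    Module.finrank ℝ (clusterSpace uh {k | (k : ℕ) ∈ J}) ≤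
      Module.finrank ℝ (clusterSpace u J) := by
  rw [finrank_clusterSpace he.orthonormal, finrank_clusterSpace heh.orthonormal]
  exact Set.ncard_le_ncard_of_injOn (fun k => (k : ℕ)) (fun k hk => hk) Fin.val_injective.injOn
    J.toFinite

theorem exists_hatEstimate (he : IsEigensystem j a b ⊤ ⊤ lam sig u) (ha : IsEnergyForm a)
    (hj : Function.Injective j) (hw : WellPosed j a b ⊤ ⊤) [CompleteSpace H] (J : Set ℕ)
    [Finite J] (ρ : ℝ) {θ : ℝ} (hθ : θ < 1) :
    ∃ C : ℝ, ∀ (Sh : Submodule ℝ S) (Mh : Submodule ℝ M)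
      (lamh : Fin (Module.finrank ℝ Mh) → ℝ) (sigh : Fin (Module.finrank ℝ Mh) → S)
      (uh : Fin (Module.finrank ℝ Mh) → M),
      IsDiscretization j a b Sh Mh ρ → IsEigensystem j a b Sh Mh lamh sigh uh →
      gap j a b Sh (clusterSpace u J) (clusterSpace uh {k | (k : ℕ) ∈ J}) ≤ θ →
      HatEstimate (solTH j a b ⊤ ⊤) (solTH j a b Sh Mh)
        (inH j (clusterSpace u J)) (inH j (clusterSpace uh {k | (k : ℕ) ∈ J}))
        (C * gap j a b Sh (clusterSpace u J) (clusterSpace uh {k | (k : ℕ) ∈ J}) ^ 2) := by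
  obtain ⟨K, hK0, hK⟩ := hw.exists_normA_solA_le ha
  obtain ⟨L, hL0, hlam⟩ := he.exists_lam_le_sq J
  have hL (x : M) (hx : x ∈ clusterSpace u J) := he.normA_G_le hw ha hlam hL0 hx
  have hW := he.isSolInvariant_clusterSpace hw J
  have hθ' : max θ 0 < 1 := max_lt hθ one_pos
  have hLh0 : 0 ≤ (L + max θ 0) / (1 - max θ 0) :=
    div_nonneg (add_nonneg hL0 (le_max_right _ _)) (sub_pos.2 hθ').le
  obtain ⟨C, hC⟩ := exists_hatEstimate_of_gap_le ha hj hw hK0 hK hW hL (le_max_right ρ 0) hLh0 hθ'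
  refine ⟨C, fun Sh Mh lamh sigh uh hd heh hgap => ?_⟩
  have hgap' := hgap.trans (le_max_left θ 0)
  have hwh := hd.wellPosed ha hj
  have hWh := heh.isSolInvariant_clusterSpace hwh {k | (k : ℕ) ∈ J}
  have hrank := he.finrank_clusterSpace_fin_le heh J
  have hinf (x : M) (hx : x ∈ clusterSpace u J) :=
    (iInf_mixedDist_le_gap_mul ha hj hw hwh hW.le_range hWh.le_range hL hx).trans
      (mul_le_mul_of_nonneg_right hgap' (norm_nonneg _))
  have hlamh : ∀ k ∈ {k : Fin (Module.finrank ℝ Mh) | (k : ℕ) ∈ J},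
      lamh k ≤ ((L + max θ 0) / (1 - max θ 0)) ^ 2 := fun k hk => by
    obtain ⟨x, hx, hxk⟩ := exists_projM_eq hj hrank (norm_le_inv_mul_norm_projM hθ' fun x hx =>
      (norm_sub_projM_le_iInf_mixedDist x).trans (hinf x hx)) (mem_clusterSpace uh hk)
    exact (Real.sqrt_le_left hLh0).1
      (heh.sqrt_lam_le_of_projM_eq hwh ha hWh.le_range hxk hθ' (hL x hx) (hinf x hx))
  exact hC Sh Mh _ (hd.mono (le_max_left ρ 0)) hWh
    (fun w hw => heh.normA_G_le hwh ha hlamh hLh0 hw) hrank hgap'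

end IsEigensystem

section Convergence

variable {ρ K : ℝ}

lemma IsDiscretization.norm_solTH_sub_le (hd : IsDiscretization j a b Sh Mh ρ)
    (ha : IsEnergyForm a) (hw : WellPosed j a b ⊤ ⊤) (hwh : WellPosed j a b Sh Mh)
    (hρ : 0 ≤ ρ) (hK0 : 0 ≤ K) (hK : ∀ g : H, normA a (solA j a b ⊤ ⊤ g) ≤ K * ‖g‖) (g : H) :
    ‖solTH j a b ⊤ ⊤ g - solTH j a b Sh Mh g‖ ≤ ρ * (1 + (K + ρ)) * ‖g‖ := by
  have := hd.finite_M
  set p := projM j Mh (solT j a b ⊤ ⊤ g) with hp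
  have happrox : ‖solTH j a b ⊤ ⊤ g - j p‖ ≤ ρ * ‖g‖ :=
    (le_ciInf fun v => norm_sub_projM_le _ v.2).trans (hd.strong_approx g _ _ (hw.source g))
  set y := p - solT j a b Sh Mh g
  have hyM : y ∈ Mh := Mh.sub_mem (projM_mem _) (hwh.solT_mem g)
  have hjy : j y = j p - solTH j a b Sh Mh g := map_sub j _ _
  have hdual : ‖j y‖ ^ 2 =
      a (solA j a b Sh Mh (j y)) (solA j a b ⊤ ⊤ g - solA j a b Sh Mh g) := by
    rw [← hd.inner_solTH_sub_inner_solTH ha hw hwh hyM (hw.isInterpolant_solA hwh g),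
      ← hwh.isSymmetric_solTH ha, solTH, LinearMap.comp_apply, ContinuousLinearMap.coe_coe,
      ← inner_projM_left _ hyM, ← hp, ← inner_sub_left, ← hjy, real_inner_self_eq_norm_sq]
  have hdiscrete : ‖j y‖ ≤ ρ * (K + ρ) * ‖g‖ := by
    refine le_of_sq_le_mul (by positivity) ?_
    calc ‖j y‖ ^ 2 ≤ ((K + ρ) * ‖j y‖) * (ρ * ‖g‖) := by
          rw [hdual]
          refine (ha.apply_le _ _).trans (mul_le_mul (hd.normA_solA_le ha hw hwh hK _)
            (hd.normA_solA_sub_le ha hw hwh g) (normA_nonneg _) (by positivity))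
      _ = ρ * (K + ρ) * ‖g‖ * ‖j y‖ := by ring
  calc ‖solTH j a b ⊤ ⊤ g - solTH j a b Sh Mh g‖
      ≤ ‖solTH j a b ⊤ ⊤ g - j p‖ + ‖j y‖ := by
        rw [hjy]
        exact norm_sub_le_norm_sub_add_norm_sub _ _ _
    _ ≤ ρ * (1 + (K + ρ)) * ‖g‖ := by linarith

end Convergence

/-- The orthonormal family `e` diagonalizes `T`, with eigenvalues `ν`: every `T x` is the sum of
its expansion along `e`. In particular `T` vanishes on the orthogonal complement of `e`, so `e`
need not be a basis. -/
structure HasEigenExpansion {I : Type*} (T : H → H) (e : I → H) (ν : I → ℝ) : Prop where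
  orthonormal : Orthonormal ℝ e
  hasSum : ∀ x, HasSum (fun i => (ν i * ⟪e i, x⟫) • e i) (T x)

lemma exists_mem_ne_zero_forall_inner_eq_zero {I : Type*} {W : Submodule ℝ H}
    [FiniteDimensional ℝ W] (f : I → H) (t : Finset I) (h : t.card < Module.finrank ℝ W) :
    ∃ w ∈ W, w ≠ 0 ∧ ∀ k ∈ t, ⟪f k, w⟫ = 0 := by
  let φ : W →ₗ[ℝ] (t → ℝ) := LinearMap.pi fun k => (innerₛₗ ℝ (f k)) ∘ₗ W.subtype
  have hker : LinearMap.ker φ ≠ ⊥ :=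
    LinearMap.ker_ne_bot_of_finrank_lt (by simpa using h)
  obtain ⟨w, hφ, hw⟩ := Submodule.exists_mem_ne_zero_of_ne_bot hker
  exact ⟨w, w.2, by simpa using hw, fun k hk => congrFun (LinearMap.mem_ker.1 hφ) ⟨k, hk⟩⟩

lemma norm_sub_sum_inner_smul_sq {I : Type*} {e : I → H} (he : Orthonormal ℝ e) (x : H)
    (s : Finset I) :
    ‖x - ∑ i ∈ s, ⟪e i, x⟫ • e i‖ ^ 2 = ‖x‖ ^ 2 - ∑ i ∈ s, ⟪e i, x⟫ ^ 2 := by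
  have hnorm := norm_sum_smul_sq (j := ContinuousLinearMap.id ℝ H) he s (fun i => ⟪e i, x⟫)
  have hinner : ⟪x, ∑ i ∈ s, ⟪e i, x⟫ • e i⟫ = ∑ i ∈ s, ⟪e i, x⟫ ^ 2 := by
    simp only [inner_sum, real_inner_smul_right, real_inner_comm x, pow_two]
  rw [ContinuousLinearMap.id_apply] at hnorm
  rw [norm_sub_sq_real, hinner, hnorm]
  ring

namespace HasEigenExpansion

variable {I : Type*} {T : H → H} {e : I → H} {ν : I → ℝ}

lemma apply_self (h : HasEigenExpansion T e ν) (i : I) : T (e i) = ν i • e i := by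
  have hi := hasSum_single (f := fun k => (ν k * ⟪e k, e i⟫) • e k) i fun k hk => by
    rw [h.orthonormal.inner_eq_zero hk, mul_zero, zero_smul]
  rw [(h.hasSum (e i)).unique hi, real_inner_self_eq_norm_sq, h.orthonormal.norm_eq_one, one_pow,
    mul_one]

lemma hasSum_inner (h : HasEigenExpansion T e ν) (x y : H) :
    HasSum (fun i => ν i * ⟪e i, x⟫ * ⟪e i, y⟫) ⟪y, T x⟫ := by
  refine ((h.hasSum x).mapL (innerSL ℝ y)).congr_fun fun i => ?_
  rw [innerSL_apply_apply, real_inner_smul_right, real_inner_comm (e i) y]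

lemma inner_apply (h : HasEigenExpansion T e ν) (i : I) (x : H) :
    ⟪e i, T x⟫ = ν i * ⟪e i, x⟫ := by
  classical
  refine (h.hasSum_inner x (e i)).unique ?_
  convert! hasSum_ite_eq i (ν i * ⟪e i, x⟫) using 2 with k
  rw [orthonormal_iff_ite.1 h.orthonormal, mul_ite, mul_one, mul_zero]
  split_ifs with hk
  · rw [hk]
  · rfl

lemma hasSum_norm_sq (h : HasEigenExpansion T e ν) (x : H) :
    HasSum (fun i => ν i ^ 2 * ⟪e i, x⟫ ^ 2) (‖T x‖ ^ 2) := by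
  rw [← real_inner_self_eq_norm_sq]
  refine (h.hasSum_inner x (T x)).congr_fun fun i => ?_
  rw [h.inner_apply]
  ring

lemma inner_self_apply_le (h : HasEigenExpansion T e ν) {x : H} {μ : ℝ} (hμ : 0 ≤ μ)
    (hx : ∀ i, ν i ≤ μ ∨ ⟪e i, x⟫ = 0) : ⟪x, T x⟫ ≤ μ * ‖x‖ ^ 2 := by
  have hle := hasSum_le (fun i => ?_) (h.hasSum_inner x x)
    ((h.orthonormal.inner_products_summable x).hasSum.mul_left μ)
  · exact hle.trans (mul_le_mul_of_nonneg_left (h.orthonormal.tsum_inner_products_le x) hμ)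
  · rw [mul_assoc, ← pow_two, Real.norm_eq_abs, sq_abs]
    rcases hx i with hν | hzero
    · gcongr
    · simp [hzero]

lemma le_inner_self_apply (h : HasEigenExpansion T e ν) {s : Set I} {μ : ℝ}
    (hμ : ∀ i ∈ s, μ ≤ ν i) {x : H} (hx : x ∈ clusterSpace e s) :
    μ * ‖x‖ ^ 2 ≤ ⟪x, T x⟫ := by
  obtain ⟨t, c, ht, rfl⟩ := exists_sum_eq_of_mem_clusterSpace hx
  have hnorm := norm_sum_smul_sq (j := ContinuousLinearMap.id ℝ H) h.orthonormal t c
  rw [ContinuousLinearMap.id_apply] at hnorm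
  rw [hnorm, sum_inner, Finset.mul_sum]
  refine Finset.sum_le_sum fun i hi => ?_
  rw [real_inner_smul_left, h.inner_apply, h.orthonormal.inner_right_sum c hi]
  nlinarith [mul_le_mul_of_nonneg_right (hμ i (ht hi)) (sq_nonneg (c i))]

/- Weyl's inequality: a vector in the span of the `e i`, `i ∈ s`, that is orthogonal to the `e' k`,
`k ∈ t`, exists by counting dimensions; on it the two quadratic forms can be compared. -/
lemma le_add_of_card_lt {I' : Type*} {T' : H → H} {e' : I' → H} {ν' : I' → ℝ}
    (h : HasEigenExpansion T e ν) (h' : HasEigenExpansion T' e' ν') {s : Set I} [Finite s]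
    {t : Finset I'} (hcard : t.card < s.ncard) {μ μ' ε : ℝ} (hμ : ∀ i ∈ s, μ ≤ ν i)
    (hμ' : ∀ k ∉ t, ν' k ≤ μ') (hμ'0 : 0 ≤ μ') (hε : ∀ x, ‖T x - T' x‖ ≤ ε * ‖x‖) :
    μ ≤ μ' + ε := by
  obtain ⟨w, hws, hw0, hwt⟩ := exists_mem_ne_zero_forall_inner_eq_zero e' t (hcard.trans_eq
    (finrank_clusterSpace (j := ContinuousLinearMap.id ℝ H) h.orthonormal).symm)
  have hlower := h.le_inner_self_apply hμ hws
  have hupper := h'.inner_self_apply_le hμ'0 fun k =>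
    (em (k ∈ t)).symm.imp (hμ' k) (hwt k)
  have hdiff : ⟪w, T w - T' w⟫ ≤ ε * ‖w‖ ^ 2 :=
    (real_inner_le_norm _ _).trans
      ((mul_le_mul_of_nonneg_left (hε w) (norm_nonneg w)).trans_eq (by ring))
  rw [inner_sub_right] at hdiff
  exact le_of_mul_le_mul_right (by linarith : μ * ‖w‖ ^ 2 ≤ (μ' + ε) * ‖w‖ ^ 2)
    (pow_pos (norm_pos_iff.2 hw0) 2)

lemma mul_norm_sub_sum_le (h : HasEigenExpansion T e ν) {s : Finset I} {r μ : ℝ} (hr : 0 ≤ r)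
    (hμ : r ≤ |μ|) (hν : ∀ i ∉ s, r ≤ |ν i - μ|) (x : H) :
    r * ‖x - ∑ i ∈ s, ⟪e i, x⟫ • e i‖ ≤ ‖T x - μ • x‖ := by
  have hexpand : ‖T x - μ • x‖ ^ 2 = ‖T x‖ ^ 2 - 2 * μ * ⟪x, T x⟫ + μ ^ 2 * ‖x‖ ^ 2 := by
    rw [norm_sub_sq_real, real_inner_smul_right, norm_smul, mul_pow, Real.norm_eq_abs, sq_abs,
      real_inner_comm]
    ring
  have hbessel := h.orthonormal.tsum_inner_products_le x
  have hsum_sq := (h.orthonormal.inner_products_summable x).hasSum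
  simp only [Real.norm_eq_abs, sq_abs] at hbessel hsum_sq
  have hsum_s := hasSum_subtype_iff_indicator.1 (s.hasSum fun i => ⟪e i, x⟫ ^ 2)
  have hterms := (((h.hasSum_norm_sq x).sub ((h.hasSum_inner x x).mul_left (2 * μ))).add
    (hsum_sq.mul_left (μ ^ 2 - r ^ 2))).add (hsum_s.mul_left (r ^ 2))
  have hnonneg := hterms.nonneg fun i => ?_
  · have hle : r ^ 2 ≤ μ ^ 2 := sq_le_sq.2 (by rwa [abs_of_nonneg hr])
    refine le_of_sq_le_sq ?_ (norm_nonneg _)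
    rw [mul_pow, norm_sub_sum_inner_smul_sq h.orthonormal, hexpand]
    nlinarith [mul_le_mul_of_nonneg_left hbessel (sub_nonneg.2 hle)]
  · by_cases hi : i ∈ s
    · rw [Set.indicator_of_mem (Finset.mem_coe.2 hi)]
      nlinarith [sq_nonneg ((ν i - μ) * ⟪e i, x⟫)]
    · have hle : r ^ 2 ≤ (ν i - μ) ^ 2 := sq_le_sq.2 (by rw [abs_of_nonneg hr]; exact hν i hi)
      rw [Set.indicator_of_notMem (mt Finset.mem_coe.1 hi)]
      nlinarith [mul_le_mul_of_nonneg_right hle (sq_nonneg ⟪e i, x⟫)]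

end HasEigenExpansion

namespace IsEigensystem

variable {I : Type*} [Preorder I] {lam : I → ℝ} {sig : I → S} {u : I → M}

lemma inner_solTH (he : IsEigensystem j a b Sh Mh lam sig u) (hw : WellPosed j a b Sh Mh)
    (ha : IsEnergyForm a) (i : I) (x : H) :
    ⟪j (u i), solTH j a b Sh Mh x⟫ = (lam i)⁻¹ * ⟪j (u i), x⟫ := by
  rw [← hw.isSymmetric_solTH ha, solTH, LinearMap.comp_apply, he.solT_apply hw,
    ContinuousLinearMap.coe_coe, map_smul, real_inner_smul_left]

lemma inv_le_inv {i k : I} (he : IsEigensystem j a b Sh Mh lam sig u) (h : i ≤ k) :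
    (lam k)⁻¹ ≤ (lam i)⁻¹ :=
  inv_anti₀ (he.pos i) (he.mono h)

lemma orthogonal_span_eq_bot [CompleteSpace H] (he : IsEigensystem j a b ⊤ ⊤ lam sig u)
    (hw : WellPosed j a b ⊤ ⊤) (ha : IsEnergyForm a) (hj : Function.Injective j)
    (hjd : DenseRange j) (hc : IsCompactOperator (solTH j a b ⊤ ⊤)) :
    (Submodule.span ℝ (Set.range fun i => j (u i)))ᗮ = ⊥ := by
  rw [eq_bot_iff, ← ContinuousLinearMap.orthogonalComplement_iSup_eigenspaces_eq_bot
    (T := ContinuousLinearMap.mkOfIsCompactOperator hc) hc (hw.isSymmetric_solTH ha)]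
  refine Submodule.orthogonal_le (iSup_le fun μ x hx => ?_)
  have hx' : j (solT j a b ⊤ ⊤ x) = μ • x := Module.End.mem_eigenspace_iff.1 hx
  rcases eq_or_ne μ 0 with rfl | hμ
  · rw [zero_smul, map_eq_zero_iff j hj, map_eq_zero_iff _ (hw.solT_injective ha hjd)] at hx'
    rw [hx']
    exact Submodule.zero_mem _
  · have hjx : j (μ⁻¹ • solT j a b ⊤ ⊤ x) = x := by
      rw [map_smul, hx', inv_smul_smul₀ hμ]
    obtain ⟨hσ, hv, hτ, hb⟩ := (hw.source x).smul μ⁻¹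
    have heigen : IsEigenSolution j a b ⊤ ⊤ μ⁻¹ (μ⁻¹ • solA j a b ⊤ ⊤ x)
        (μ⁻¹ • solT j a b ⊤ ⊤ x) :=
      ⟨hσ, hv, hτ, fun v hv => by rw [hb v hv, hjx, real_inner_smul_left, neg_mul]⟩
    have hmem := Submodule.mem_map_of_mem (f := (j : M →ₗ[ℝ] H)) (he.complete _ _ _ heigen)
    rw [Submodule.map_span, ContinuousLinearMap.coe_coe, hjx] at hmem
    refine Submodule.span_mono ?_ hmem
    rintro _ ⟨_, ⟨i, -, rfl⟩, rfl⟩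
    exact ⟨i, rfl⟩

lemma hasEigenExpansion [CompleteSpace H] (he : IsEigensystem j a b ⊤ ⊤ lam sig u)
    (hw : WellPosed j a b ⊤ ⊤) (ha : IsEnergyForm a) (hj : Function.Injective j)
    (hjd : DenseRange j) (hc : IsCompactOperator (solTH j a b ⊤ ⊤)) :
    HasEigenExpansion (solTH j a b ⊤ ⊤) (fun i => j (u i)) (fun i => (lam i)⁻¹) where
  orthonormal := he.orthonormal
  hasSum x := by
    let B := HilbertBasis.mkOfOrthogonalEqBot he.orthonormal
      (he.orthogonal_span_eq_bot hw ha hj hjd hc)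
    refine (B.hasSum_repr (solTH j a b ⊤ ⊤ x)).congr_fun fun i => ?_
    rw [HilbertBasis.repr_apply_apply, HilbertBasis.coe_mkOfOrthogonalEqBot, he.inner_solTH hw ha]

lemma hasEigenExpansion_of_card [Fintype I] [FiniteDimensional ℝ Mh]
    (he : IsEigensystem j a b Sh Mh lam sig u) (hw : WellPosed j a b Sh Mh) (ha : IsEnergyForm a)
    (hcard : Fintype.card I = Module.finrank ℝ Mh) :
    HasEigenExpansion (solTH j a b Sh Mh) (fun i => j (u i)) (fun i => (lam i)⁻¹) where
  orthonormal := he.orthonormal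
  hasSum x := by
    have hspan : Submodule.span ℝ (Set.range u) = Mh := by
      refine Submodule.eq_of_le_of_finrank_eq (Submodule.span_le.2 ?_) ?_
      · rintro _ ⟨i, rfl⟩
        exact (he.eigen i).2.1
      · rw [← hcard]
        exact finrank_span_eq_card
          (LinearIndependent.of_comp (j : M →ₗ[ℝ] H) he.orthonormal.linearIndependent)
    obtain ⟨c, hc⟩ := (Submodule.mem_span_range_iff_exists_fun ℝ).1
      (hspan.ge (hw.solT_mem x))
    have hexp : solTH j a b Sh Mh x = ∑ i, c i • j (u i) := by
      rw [solTH, LinearMap.comp_apply, ← hc, ContinuousLinearMap.coe_coe, map_sum]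
      simp only [map_smul]
    rw [hexp]
    refine (hasSum_fintype _).congr_fun fun i => ?_
    rw [← he.inner_solTH hw ha, hexp, he.orthonormal.inner_right_fintype]

end IsEigensystem

section Separated

variable {lam : ℕ → ℝ} {sig : ℕ → S} {u : ℕ → M}
  {d : ℕ} {lamh : Fin d → ℝ} {sigh : Fin d → S} {uh : Fin d → M}

lemma IsEigensystem.abs_inv_sub_inv_le {T Th : H → H} {ε : ℝ}
    (he : IsEigensystem j a b ⊤ ⊤ lam sig u) (heh : IsEigensystem j a b Sh Mh lamh sigh uh)
    (hT : HasEigenExpansion T (fun i => j (u i)) fun i => (lam i)⁻¹)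
    (hTh : HasEigenExpansion Th (fun k => j (uh k)) fun k => (lamh k)⁻¹)
    (hε : ∀ g, ‖T g - Th g‖ ≤ ε * ‖g‖) (k : Fin d) :
    |(lamh k)⁻¹ - (lam k)⁻¹| ≤ ε := by
  have hlower : (lam k)⁻¹ ≤ (lamh k)⁻¹ + ε := by
    refine hT.le_add_of_card_lt hTh (s := Set.Iic (k : ℕ)) (t := Finset.Iio k) ?_
      (fun i hi => he.inv_le_inv hi) (fun i hi => ?_) (inv_nonneg.2 (heh.pos k).le) hε
    · rw [Fin.card_Iio, Set.ncard_eq_toFinset_card']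
      simp
    · exact heh.inv_le_inv (not_lt.1 (mt Finset.mem_Iio.2 hi))
  have hupper : (lamh k)⁻¹ ≤ (lam k)⁻¹ + ε := by
    refine hTh.le_add_of_card_lt hT (s := Set.Iic k) (t := Finset.Iio (k : ℕ)) ?_
      (fun i hi => heh.inv_le_inv hi) (fun i hi => ?_) (inv_nonneg.2 (he.pos k).le)
      (fun g => by rw [norm_sub_rev]; exact hε g)
    · rw [Nat.card_Iio, Set.ncard_eq_toFinset_card']
      simp
    · exact he.inv_le_inv (not_lt.1 (mt Finset.mem_Iio.2 hi))
  rw [abs_sub_le_iff]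
  constructor <;> linarith

/- Beyond an upper bound of `J` the distance to `(lam k)⁻¹` increases with `k`, so only finitely
many distances matter. -/
lemma exists_pos_le_abs_inv_sub_inv (hpos : ∀ i, 0 < lam i) (hmono : Monotone lam) {J : Set ℕ}
    (hJ : J.Finite) (hsep : ∀ i ∈ J, ∀ k ∉ J, lam i ≠ lam k) :
    ∃ s : ℝ, 0 < s ∧ ∀ i ∈ J, s ≤ (lam i)⁻¹ ∧ ∀ k ∉ J, s ≤ |(lam k)⁻¹ - (lam i)⁻¹| := by
  obtain ⟨m, hm⟩ := hJ.bddAbove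
  have hsmall {r : ℝ} (hr : 0 < r) : ∀ᶠ s in nhdsWithin (0 : ℝ) (Set.Ioi 0), s ≤ r :=
    (eventually_le_nhds hr).filter_mono nhdsWithin_le_nhds
  have hfin : (Set.Iic (m + 1) \ J).Finite := (Set.finite_Iic _).sdiff
  have hev : ∀ᶠ s in nhdsWithin (0 : ℝ) (Set.Ioi 0), 0 < s ∧ ∀ i ∈ J, s ≤ (lam i)⁻¹ ∧
      ∀ k ∈ Set.Iic (m + 1) \ J, s ≤ |(lam k)⁻¹ - (lam i)⁻¹| :=
    eventually_mem_nhdsWithin.and <| (Filter.eventually_all_finite hJ).2 fun i hi =>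
      (hsmall (inv_pos.2 (hpos i))).and <| (Filter.eventually_all_finite hfin).2 fun k hk =>
        hsmall (abs_pos.2 (sub_ne_zero.2 fun h => hsep i hi k hk.2 (inv_injective h).symm))
  obtain ⟨s, hs, hsJ⟩ := hev.exists
  refine ⟨s, hs, fun i hi => ⟨(hsJ i hi).1, fun k hk => ?_⟩⟩
  rcases le_total k (m + 1) with hkm | hkm
  · exact (hsJ i hi).2 k ⟨hkm, hk⟩
  · have him : i ≤ m + 1 := (hm hi).trans m.le_succ
    have hle := (hsJ i hi).2 (m + 1) ⟨Set.mem_Iic.2 le_rfl, fun h => (hm h).not_gt m.lt_succ_self⟩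
    have hki := inv_anti₀ (hpos _) (hmono hkm)
    have hmi := inv_anti₀ (hpos i) (hmono him)
    rw [abs_of_nonpos (by linarith)] at hle ⊢
    linarith

lemma norm_sub_projM_le_div {Th : H → H} {Jh : Set (Fin d)}
    (hTh : HasEigenExpansion Th (fun k => j (uh k)) fun k => (lamh k)⁻¹) {r μ ε : ℝ} (hr : 0 < r)
    (hμ : r ≤ |μ|) (hν : ∀ k ∉ Jh, r ≤ |(lamh k)⁻¹ - μ|) {x : M} (hx : ‖Th (j x) - μ • j x‖ ≤ ε) :
    ‖j x - j (projM j (clusterSpace uh Jh) x)‖ ≤ ε / r := by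
  classical
  set v : M := ∑ k ∈ Jh.toFinset, ⟪j (uh k), j x⟫ • uh k with hv
  have hvJ : v ∈ clusterSpace uh Jh := Submodule.sum_mem _ fun k hk =>
    Submodule.smul_mem _ _ (mem_clusterSpace uh (Set.mem_toFinset.1 hk))
  have hle := hTh.mul_norm_sub_sum_le (s := Jh.toFinset) hr.le hμ
    (fun k hk => hν k (mt Set.mem_toFinset.2 hk)) (j x)
  refine (norm_sub_projM_le x hvJ).trans ((le_div_iff₀' hr).2 ?_)
  simp only [hv, map_sum, map_smul]
  exact hle.trans hx

lemma norm_sub_projM_le_of_mem_clusterSpace {I : Type*} {u : I → M} {J : Set I} [Finite J]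
    {Wh : Submodule ℝ M} [FiniteDimensional ℝ Wh] (ho : Orthonormal ℝ fun i => j (u i)) {η : ℝ}
    (h : ∀ i ∈ J, ‖j (u i) - j (projM j Wh (u i))‖ ≤ η) (hη : 0 ≤ η) {x : M}
    (hx : x ∈ clusterSpace u J) :
    ‖j x - j (projM j Wh x)‖ ≤ J.ncard * η * ‖j x‖ := by
  obtain ⟨s, c, hs, rfl⟩ := exists_sum_eq_of_mem_clusterSpace hx
  set x := ∑ i ∈ s, c i • u i with hx_def
  have hcoeff : ∀ i ∈ s, |c i| ≤ ‖j x‖ := fun i hi => by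
    refine abs_le_of_sq_le_sq ?_ (norm_nonneg _)
    rw [norm_sum_smul_sq ho]
    exact Finset.single_le_sum (f := fun i => c i ^ 2) (fun k _ => sq_nonneg _) hi
  have hmem : ∑ i ∈ s, c i • projM j Wh (u i) ∈ Wh :=
    Submodule.sum_mem _ fun i _ => Submodule.smul_mem _ _ (projM_mem _)
  calc ‖j x - j (projM j Wh x)‖
      ≤ ‖j x - j (∑ i ∈ s, c i • projM j Wh (u i))‖ := norm_sub_projM_le x hmem
    _ = ‖∑ i ∈ s, c i • (j (u i) - j (projM j Wh (u i)))‖ := by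
        simp only [hx_def, map_sum, map_smul, smul_sub, Finset.sum_sub_distrib]
    _ ≤ ∑ _ ∈ s, ‖j x‖ * η := norm_sum_le_of_le _ fun _ hi => by
        rw [norm_smul]
        exact mul_le_mul (hcoeff _ hi) (h _ (hs hi)) (norm_nonneg _) (norm_nonneg _)
    _ = s.card * η * ‖j x‖ := by rw [Finset.sum_const, nsmul_eq_mul]; ring
    _ ≤ J.ncard * η * ‖j x‖ := by
        gcongr
        rw [← Set.ncard_coe_finset]
        exact Set.ncard_le_ncard hs J.toFinite

end Separated

section GapConvergence

lemma gap_le_of_norm_sub_projM_le {W Wh : Submodule ℝ M} [FiniteDimensional ℝ Wh] {ρ K Λ η : ℝ}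
    (hd : IsDiscretization j a b Sh Mh ρ) (ha : IsEnergyForm a) (hw : WellPosed j a b ⊤ ⊤)
    (hwh : WellPosed j a b Sh Mh) (hρ : 0 ≤ ρ) (hK0 : 0 ≤ K)
    (hK : ∀ g : H, normA a (solA j a b ⊤ ⊤ g) ≤ K * ‖g‖)
    (hWh : ∀ w ∈ Wh, solT j a b Sh Mh (j w) ∈ Wh) (hΛ : 0 ≤ Λ)
    (hW : ∀ x ∈ W, ∃ g ∈ W, solT j a b ⊤ ⊤ (j g) = x ∧ ‖j g‖ ≤ Λ * ‖j x‖) (hη0 : 0 ≤ η)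
    (hη : ∀ g ∈ W, ‖j g - j (projM j Wh g)‖ ≤ η * ‖j g‖) :
    gap j a b Sh W Wh ≤
      (ρ * (1 + (K + ρ)) + ρ + ((K + ρ) ^ 2 + (K + ρ)) * η) * Λ := by
  refine gap_le (by positivity) fun x hx hx1 => ?_
  obtain ⟨g, hg, rfl, hgΛ⟩ := hW x hx
  rw [hx1, mul_one] at hgΛ
  have hKh := hd.normA_solA_le ha hw hwh hK
  set p := projM j Wh g
  have hnorm : ‖j (solT j a b ⊤ ⊤ (j g)) - j (solT j a b Sh Mh (j p))‖ ≤
      ρ * (1 + (K + ρ)) * ‖j g‖ + (K + ρ) ^ 2 * (η * ‖j g‖) := by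
    refine (norm_sub_le_norm_sub_add_norm_sub _ (solTH j a b Sh Mh (j g)) _).trans
      (add_le_add (hd.norm_solTH_sub_le ha hw hwh hρ hK0 hK (j g)) ?_)
    change ‖solTH j a b Sh Mh (j g) - solTH j a b Sh Mh (j p)‖ ≤ _
    rw [← map_sub]
    exact (hwh.norm_solTH_le ha hKh _).trans (by gcongr; exact hη g hg)
  have henergy : normA a (G a b ⊤ (solT j a b ⊤ ⊤ (j g)) - G a b Sh (solT j a b Sh Mh (j p))) ≤
      ρ * ‖j g‖ + (K + ρ) * (η * ‖j g‖) := by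
    rw [hw.G_solT ha, hwh.G_solT ha]
    refine (ha.normA_sub_le _ (solA j a b Sh Mh (j g)) _).trans
      (add_le_add (hd.normA_solA_sub_le ha hw hwh (j g)) ?_)
    rw [← map_sub]
    exact (hKh _).trans (by gcongr; exact hη g hg)
  refine ⟨solT j a b Sh Mh (j p), hWh p (projM_mem g), (mixedDist_le_add _ _).trans ?_⟩
  calc _ ≤ (ρ * (1 + (K + ρ)) + ρ + ((K + ρ) ^ 2 + (K + ρ)) * η) * ‖j g‖ :=
        (add_le_add hnorm henergy).trans_eq (by ring)
    _ ≤ _ := by gcongr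

namespace IsEigensystem

variable {lam : ℕ → ℝ} {sig : ℕ → S} {u : ℕ → M}
  {d : ℕ} {lamh : Fin d → ℝ} {sigh : Fin d → S} {uh : Fin d → M}

lemma norm_sub_projM_le_of_separated {T Th : H → H} {J : Set ℕ} {s ε : ℝ}
    (he : IsEigensystem j a b ⊤ ⊤ lam sig u) (heh : IsEigensystem j a b Sh Mh lamh sigh uh)
    (hT : HasEigenExpansion T (fun i => j (u i)) fun i => (lam i)⁻¹)
    (hTh : HasEigenExpansion Th (fun k => j (uh k)) fun k => (lamh k)⁻¹)
    (hε : ∀ g, ‖T g - Th g‖ ≤ ε * ‖g‖) (hs : 0 < s) (hεs : ε ≤ s / 2) {i : ℕ}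
    (hi : s ≤ (lam i)⁻¹) (hsep : ∀ k ∉ J, s ≤ |(lam k)⁻¹ - (lam i)⁻¹|) :
    ‖j (u i) - j (projM j (clusterSpace uh {k | (k : ℕ) ∈ J}) (u i))‖ ≤ ε / (s / 2) := by
  have hgap : ∀ k ∉ {k : Fin d | (k : ℕ) ∈ J}, s / 2 ≤ |(lamh k)⁻¹ - (lam i)⁻¹| := fun k hk => by
    have htri := abs_sub_le (lam k)⁻¹ (lamh k)⁻¹ (lam i)⁻¹
    rw [abs_sub_comm (lam k)⁻¹ (lamh k)⁻¹] at htri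
    linarith [hsep k hk, he.abs_inv_sub_inv_le heh hT hTh hε k]
  refine norm_sub_projM_le_div hTh (half_pos hs) ?_ hgap ?_
  · linarith [le_abs_self (lam i)⁻¹]
  · have hle := hε (j (u i))
    rwa [hT.apply_self, he.orthonormal.norm_eq_one, mul_one, norm_sub_rev] at hle

theorem exists_gap_le [CompleteSpace H] (he : IsEigensystem j a b ⊤ ⊤ lam sig u)
    (ha : IsEnergyForm a) (hj : Function.Injective j) (hjd : DenseRange j)
    (hw : WellPosed j a b ⊤ ⊤) (hc : IsCompactOperator (solTH j a b ⊤ ⊤)) {J : Set ℕ} [Finite J]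
    (hsep : ∀ i ∈ J, ∀ k ∉ J, lam i ≠ lam k) {θ : ℝ} (hθ : 0 < θ) :
    ∃ ρ : ℝ, 0 < ρ ∧ ∀ (Sh : Submodule ℝ S) (Mh : Submodule ℝ M)
      (lamh : Fin (Module.finrank ℝ Mh) → ℝ) (sigh : Fin (Module.finrank ℝ Mh) → S)
      (uh : Fin (Module.finrank ℝ Mh) → M),
      IsDiscretization j a b Sh Mh ρ → IsEigensystem j a b Sh Mh lamh sigh uh →
      gap j a b Sh (clusterSpace u J) (clusterSpace uh {k | (k : ℕ) ∈ J}) ≤ θ := by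
  obtain ⟨K, hK0, hK⟩ := hw.exists_normA_solA_le ha
  obtain ⟨L, -, hL⟩ := he.exists_lam_le_sq J
  obtain ⟨s, hs, hsJ⟩ := exists_pos_le_abs_inv_sub_inv he.pos he.mono J.toFinite hsep
  let ε (ρ : ℝ) : ℝ := ρ * (1 + (K + ρ))
  let bound (ρ : ℝ) : ℝ :=
    (ε ρ + ρ + ((K + ρ) ^ 2 + (K + ρ)) * (J.ncard * (ε ρ / (s / 2)))) * L ^ 2
  have hsmall {f : ℝ → ℝ} (hf : Continuous f) (hf0 : f 0 = 0) {r : ℝ} (hr : 0 < r) :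
      ∀ᶠ ρ in nhdsWithin 0 (Set.Ioi 0), f ρ ≤ r :=
    ((hf.tendsto' 0 0 hf0).eventually (eventually_le_nhds hr)).filter_mono nhdsWithin_le_nhds
  obtain ⟨ρ, ⟨hερ, hbound⟩, hρ⟩ :=
    ((hsmall (f := ε) (by fun_prop) (by simp [ε]) (half_pos hs)).and
      (hsmall (f := bound) (by fun_prop) (by simp [bound, ε]) hθ)).and
      eventually_mem_nhdsWithin |>.exists
  have hρ0 : 0 < ρ := hρ
  refine ⟨ρ, hρ0, fun Sh Mh lamh sigh uh hd heh => ?_⟩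
  have hwh := hd.wellPosed ha hj
  have := hd.finite_M
  have hη (i : ℕ) (hi : i ∈ J) := he.norm_sub_projM_le_of_separated heh
    (he.hasEigenExpansion hw ha hj hjd hc) (heh.hasEigenExpansion_of_card hwh ha (by simp))
    (hd.norm_solTH_sub_le ha hw hwh hρ0.le hK0 hK) hs hερ (hsJ i hi).1 (hsJ i hi).2
  refine (gap_le_of_norm_sub_projM_le hd ha hw hwh hρ0.le hK0 hK
    (heh.isSolInvariant_clusterSpace hwh _).solT_mem (sq_nonneg L)
    (fun x hx => he.exists_solT_eq hw hL (sq_nonneg L) hx) (by positivity)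
    fun g hg => norm_sub_projM_le_of_mem_clusterSpace he.orthonormal hη (by positivity) hg).trans
    hbound

end IsEigensystem

end GapConvergence

end MixedEVP

end

open MixedEVP in
theorem mainTheorem3_general {S M H : Type*}
    [NormedAddCommGroup S] [InnerProductSpace ℝ S] [CompleteSpace S]
    [NormedAddCommGroup M] [InnerProductSpace ℝ M] [CompleteSpace M]
    [NormedAddCommGroup H] [InnerProductSpace ℝ H] [CompleteSpace H]
    (j : M →L[ℝ] H) (a : S →L[ℝ] S →L[ℝ] ℝ) (b : S →L[ℝ] M →L[ℝ] ℝ)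
    (hset : IsMixedSetting j a b) (lam : ℕ → ℝ) (sig : ℕ → S) (u : ℕ → M)
    (heig : IsEigensystem j a b ⊤ ⊤ lam sig u) (J : Set ℕ) [Finite J] :
    WellPosed j a b ⊤ ⊤ ∧
    (∀ R θ : ℝ, θ < 1 → ∃ C : ℝ,
      ∀ (Sh : Submodule ℝ S) (Mh : Submodule ℝ M)
        (lamh : Fin (Module.finrank ℝ Mh) → ℝ) (sigh : Fin (Module.finrank ℝ Mh) → S)
        (uh : Fin (Module.finrank ℝ Mh) → M),
        IsDiscretization j a b Sh Mh R → IsEigensystem j a b Sh Mh lamh sigh uh →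
        gap j a b Sh (clusterSpace u J) (clusterSpace uh {k | (k : ℕ) ∈ J}) ≤ θ →
        WellPosed j a b Sh Mh ∧
        HatEstimate (solTH j a b ⊤ ⊤) (solTH j a b Sh Mh)
          (inH j (clusterSpace u J)) (inH j (clusterSpace uh {k | (k : ℕ) ∈ J}))
          (C * gap j a b Sh (clusterSpace u J) (clusterSpace uh {k | (k : ℕ) ∈ J}) ^ 2)) ∧
    (IsCompactOperator (solTH j a b ⊤ ⊤) → (∀ i ∈ J, ∀ k ∉ J, lam i ≠ lam k) →
      ∃ ρ₀ : ℝ, 0 < ρ₀ ∧ ∃ C : ℝ,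
      ∀ (Sh : Submodule ℝ S) (Mh : Submodule ℝ M)
        (lamh : Fin (Module.finrank ℝ Mh) → ℝ) (sigh : Fin (Module.finrank ℝ Mh) → S)
        (uh : Fin (Module.finrank ℝ Mh) → M),
        IsDiscretization j a b Sh Mh ρ₀ → IsEigensystem j a b Sh Mh lamh sigh uh →
        WellPosed j a b Sh Mh ∧
        HatEstimate (solTH j a b ⊤ ⊤) (solTH j a b Sh Mh)
          (inH j (clusterSpace u J)) (inH j (clusterSpace uh {k | (k : ℕ) ∈ J}))
          (C * gap j a b Sh (clusterSpace u J) (clusterSpace uh {k | (k : ℕ) ∈ J}) ^ 2)) := by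
  have hw := hset.wellPosed
  have ha := hset.isEnergyForm
  have hj := hset.embedding_injective
  refine ⟨hw, fun R θ hθ => ?_, fun hc hsep => ?_⟩
  · obtain ⟨C, hC⟩ := heig.exists_hatEstimate ha hj hw J R hθ
    exact ⟨C, fun Sh Mh lamh sigh uh hd heh hgap =>
      ⟨hd.wellPosed ha hj, hC Sh Mh lamh sigh uh hd heh hgap⟩⟩
  · obtain ⟨ρ, hρ, hgap⟩ :=
      heig.exists_gap_le ha hj hset.embedding_dense hw hc hsep (one_half_pos (α := ℝ))
    obtain ⟨C, hC⟩ := heig.exists_hatEstimate ha hj hw J ρ one_half_lt_one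
    exact ⟨ρ, hρ, C, fun Sh Mh lamh sigh uh hd heh =>
      ⟨hd.wellPosed ha hj, hC Sh Mh lamh sigh uh hd heh (hgap Sh Mh lamh sigh uh hd heh)⟩⟩

theorem mainTheorem3 {S M H : Type*}
    [NormedAddCommGroup S] [InnerProductSpace ℝ S] [CompleteSpace S]
    [NormedAddCommGroup M] [InnerProductSpace ℝ M] [CompleteSpace M]
    [NormedAddCommGroup H] [InnerProductSpace ℝ H] [CompleteSpace H]
    (j : M →L[ℝ] H) (a : S →L[ℝ] S →L[ℝ] ℝ) (b : S →L[ℝ] M →L[ℝ] ℝ)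
    (hset : MixedEVP.IsMixedSetting j a b)
    (hcompact : IsCompactOperator (MixedEVP.solTH j a b ⊤ ⊤))
    (lam : ℕ → ℝ) (sig : ℕ → S) (u : ℕ → M)
    (heig : MixedEVP.IsEigensystem j a b ⊤ ⊤ lam sig u)
    (n N : ℕ) :
    MixedEVP.WellPosed j a b ⊤ ⊤ ∧
    -- every discretization with `ρ ≤ R` and gap at most `θ < 1`
    (∀ R θ : ℝ, θ < 1 → ∃ C : ℝ,
      ∀ (Sh : Submodule ℝ S) (Mh : Submodule ℝ M)
        (lamh : Fin (Module.finrank ℝ Mh) → ℝ) (sigh : Fin (Module.finrank ℝ Mh) → S)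
        (uh : Fin (Module.finrank ℝ Mh) → M),
        MixedEVP.IsDiscretization j a b Sh Mh R →
        MixedEVP.IsEigensystem j a b Sh Mh lamh sigh uh →
        MixedEVP.gap j a b Sh (MixedEVP.clusterSpace u (Set.Ico n (n + N)))
          (MixedEVP.clusterSpace uh {k | (k : ℕ) ∈ Set.Ico n (n + N)}) ≤ θ →
        MixedEVP.WellPosed j a b Sh Mh ∧
        MixedEVP.HatEstimate (MixedEVP.solTH j a b ⊤ ⊤) (MixedEVP.solTH j a b Sh Mh)
          (MixedEVP.inH j (MixedEVP.clusterSpace u (Set.Ico n (n + N))))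
          (MixedEVP.inH j (MixedEVP.clusterSpace uh {k | (k : ℕ) ∈ Set.Ico n (n + N)}))
          (C * MixedEVP.gap j a b Sh (MixedEVP.clusterSpace u (Set.Ico n (n + N)))
            (MixedEVP.clusterSpace uh {k | (k : ℕ) ∈ Set.Ico n (n + N)}) ^ 2)) ∧
    -- every sufficiently fine discretization, if the cluster is separated from the other eigenvalues
    ((∀ i ∈ Set.Ico n (n + N), ∀ k ∉ Set.Ico n (n + N), lam i ≠ lam k) →
      ∃ ρ₀ : ℝ, 0 < ρ₀ ∧ ∃ C : ℝ,
      ∀ (Sh : Submodule ℝ S) (Mh : Submodule ℝ M)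
        (lamh : Fin (Module.finrank ℝ Mh) → ℝ) (sigh : Fin (Module.finrank ℝ Mh) → S)
        (uh : Fin (Module.finrank ℝ Mh) → M),
        MixedEVP.IsDiscretization j a b Sh Mh ρ₀ →
        MixedEVP.IsEigensystem j a b Sh Mh lamh sigh uh →
        MixedEVP.WellPosed j a b Sh Mh ∧
        MixedEVP.HatEstimate (MixedEVP.solTH j a b ⊤ ⊤) (MixedEVP.solTH j a b Sh Mh)
          (MixedEVP.inH j (MixedEVP.clusterSpace u (Set.Ico n (n + N))))
          (MixedEVP.inH j (MixedEVP.clusterSpace uh {k | (k : ℕ) ∈ Set.Ico n (n + N)}))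
          (C * MixedEVP.gap j a b Sh (MixedEVP.clusterSpace u (Set.Ico n (n + N)))
            (MixedEVP.clusterSpace uh {k | (k : ℕ) ∈ Set.Ico n (n + N)}) ^ 2)) := by
  obtain ⟨hw, hi, hii⟩ :=
    mainTheorem3_general j a b hset lam sig u heig (Set.Ico n (n + N))
  exact ⟨hw, hi, hii hcompact⟩
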